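/- Let $\eta,\theta$ be real numbers with $1+\eta\theta\ge 0$. For $0\le s<t$ and $x\in\mathbb R$ define monic polynomials in $y$ by $Q_0=1$, $Q_1=y-x$, $$yQ_1=Q_2+((t-s)\eta+\theta)Q_1+(t-s)(1+x\eta)Q_0,\qquad yQ_n=Q_{n+1}+(t\eta+\theta)Q_n+t(1+\eta\theta)Q_{n-1}\quad(n\ge 2).$$ When $1+x\eta\ge 0$, let $P_{s,t}(x,dy)$ be the probability measure on $\mathbb R$ with finite moments of all orders for which the polynomials $(Q_n)_{n\ge 0}$ are pairwise orthogonal. Let $(X_t)_{t\ge 0}$ be a square-integrable real stochastic process on a probability space such that $E(X_t)=0$ and $E(X_sX_t)=\min\{s,t\}$ for all $s,t\ge 0$. Write $\mathcal F_s=\sigma\{X_r: r\in[0,s]\}$ and $\mathcal G_{s,u}=\sigma\{X_r: r\in[0,s]\cup[u,\infty)\}$, and suppose that for all $0\le s<t<u$, almost surely, $$E(X_t\mid\mathcal G_{s,u})=\frac{u-t}{u-s}X_s+\frac{t-s}{u-s}X_u$$ and $$\mathrm{Var}(X_t\mid\mathcal G_{s,u})=\frac{(u-t)(t-s)}{u}\left(1+\eta\,\frac{uX_s-sX_u}{u-s}+\theta\,\frac{X_u-X_s}{u-s}+\frac{(X_u-X_s)(sX_u-uX_s)}{(u-s)^2}\right).$$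 Then: 1. For all $0\le s<t$ and all $x$ with $1+x\eta\ge 0$, the measure $P_{s,t}(x,dy)$ exists and is unique. 2. $(X_t)$ is a Markov process with $X_0=0$ almost surely and with transition probabilities $P_{s,t}(x,dy)$: almost surely $1+X_s\eta\ge 0$ for each $s\ge 0$, and $P(X_t\in A\mid\mathcal F_s)=P_{s,t}(X_s,A)$ almost surely for all $0\le s<t$ and all Borel sets $A\subseteq\mathbb R$. 3. $(X_t)$ has the same finite-dimensional distributions as every process $(Y_t)_{t\ge0}$, on any probability space, that is a Markov process in the sense of item 2. -/

import Mathlib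

open MeasureTheory ProbabilityTheory
open scoped NNReal

namespace BiPoisson

/-- The `σ`-field `𝓕_s = σ(X_r : r ∈ [0, s])`. -/
@[reducible] def past {Ω : Type*} (X : ℝ≥0 → Ω → ℝ) (s : ℝ≥0) : MeasurableSpace Ω :=
  ⨆ r ∈ Set.Iic s, MeasurableSpace.comap (X r) inferInstance

/-- The `σ`-field `𝓖_{s,u} = σ(X_r : r ∈ [0, s] ∪ [u, ∞))`. -/
@[reducible] def pastFuture {Ω : Type*} (X : ℝ≥0 → Ω → ℝ) (s u : ℝ≥0) : MeasurableSpace Ω :=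
  ⨆ r ∈ Set.Iic s ∪ Set.Ici u, MeasurableSpace.comap (X r) inferInstance

/-- A centered square-integrable real process on `[0, ∞)` with `E(X_s X_t) = min {s, t}`. -/
structure HasBrownianCovariance {Ω : Type*} [MeasurableSpace Ω]
    (μ : Measure Ω) (X : ℝ≥0 → Ω → ℝ) : Prop where
  measurable : ∀ t, Measurable (X t)
  memLp : ∀ t, MemLp (X t) 2 μ
  mean : ∀ t, ∫ ω, X t ω ∂μ = 0
  cov : ∀ s t, ∫ ω, X s ω * X t ω ∂μ = ((min s t : ℝ≥0) : ℝ)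

/-- Linear regressions: for `0 ≤ s < t < u`,
`E(X_t | 𝓖_{s,u}) = (u - t)/(u - s) X_s + (t - s)/(u - s) X_u` almost surely. -/
def HasLinearRegression {Ω : Type*} [MeasurableSpace Ω]
    (μ : Measure Ω) (X : ℝ≥0 → Ω → ℝ) : Prop :=
  ∀ s t u : ℝ≥0, s < t → t < u →
    μ[X t | pastFuture X s u] =ᵐ[μ] fun ω =>
      ((u : ℝ) - t) / ((u : ℝ) - s) * X s ω + ((t : ℝ) - s) / ((u : ℝ) - s) * X u ω

/-- The conditional variance condition with parameters `η, θ` (and `σ = τ = q = 0`):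
for `0 ≤ s < t < u`, almost surely `Var(X_t | 𝓖_{s,u})` equals
`(u-t)(t-s)/u (1 + η (u X_s - s X_u)/(u-s) + θ (X_u - X_s)/(u-s)
  + (X_u - X_s)(s X_u - u X_s)/(u-s)^2)`. -/
def HasFreeConditionalVariance {Ω : Type*} [MeasurableSpace Ω]
    (η θ : ℝ) (μ : Measure Ω) (X : ℝ≥0 → Ω → ℝ) : Prop :=
  ∀ s t u : ℝ≥0, s < t → t < u →
    condVar (pastFuture X s u) (X t) μ =ᵐ[μ] fun ω =>
      ((u : ℝ) - t) * ((t : ℝ) - s) / u *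
        (1 + η * ((u * X s ω - s * X u ω) / ((u : ℝ) - s))
          + θ * ((X u ω - X s ω) / ((u : ℝ) - s))
          + (X u ω - X s ω) * (s * X u ω - u * X s ω) / ((u : ℝ) - s) ^ 2)

/-- The monic polynomials `Q_n(y; x, t, s)` in the variable `y`, given by `Q_0 = 1`,
`Q_1 = y - x`, `y Q_1 = Q_2 + ((t - s) η + θ) Q_1 + (t - s)(1 + x η) Q_0` and
`y Q_n = Q_{n+1} + (t η + θ) Q_n + t (1 + η θ) Q_{n-1}` for `n ≥ 2`. -/
noncomputable def Q (η θ s t x : ℝ) : ℕ → Polynomial ℝ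
  | 0 => 1
  | 1 => Polynomial.X - Polynomial.C x
  | 2 => Polynomial.X * (Polynomial.X - Polynomial.C x)
      - Polynomial.C ((t - s) * η + θ) * (Polynomial.X - Polynomial.C x)
      - Polynomial.C ((t - s) * (1 + x * η))
  | n + 3 => Polynomial.X * Q η θ s t x (n + 2)
      - Polynomial.C (t * η + θ) * Q η θ s t x (n + 2)
      - Polynomial.C (t * (1 + η * θ)) * Q η θ s t x (n + 1)

/-- `ν` is a probability measure on `ℝ` with all moments that makes the sequence of
polynomials `p` orthogonal (some `p n` may vanish `ν`-almost everywhere). -/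
structure MakesOrthogonal (p : ℕ → Polynomial ℝ) (ν : Measure ℝ) : Prop where
  isProbabilityMeasure : IsProbabilityMeasure ν
  integrable_pow : ∀ n : ℕ, Integrable (fun y : ℝ => y ^ n) ν
  orthogonal : ∀ m n : ℕ, m ≠ n → ∫ y, (p m).eval y * (p n).eval y ∂ν = 0

open Classical in
/-- The transition probability `P_{s,t}(x, dy)`: the probability measure that makes the
polynomials `Q_n(y; x, t, s)` orthogonal. It is meant for `0 ≤ s < t`, `1 + η θ ≥ 0` and
`1 + x η ≥ 0`; the value is `0` if there is no such measure. -/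
noncomputable def transitionLaw (η θ s t x : ℝ) : Measure ℝ :=
  if h : ∃ ν : Measure ℝ, MakesOrthogonal (Q η θ s t x) ν then h.choose else 0

/-- `Y` is the Markov process (with respect to its own filtration) started at `Y_0 = 0`, with
values in the set `{x | 1 + x η ≥ 0}` on which the transition probabilities `P_{s,t}(x, dy)` are
defined, and with these transition probabilities: for `0 ≤ s < t` and every Borel set `A`,
`P(Y_t ∈ A | 𝓕_s) = P_{s,t}(Y_s, A)` almost surely. -/
structure IsFreeBiPoissonProcess {Ω : Type*} [MeasurableSpace Ω]
    (η θ : ℝ) (μ : Measure Ω) (Y : ℝ≥0 → Ω → ℝ) : Prop where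
  measurable : ∀ t, Measurable (Y t)
  start : ∀ᵐ ω ∂μ, Y 0 ω = 0
  mem_stateSpace : ∀ s, ∀ᵐ ω ∂μ, 0 ≤ 1 + Y s ω * η
  transition : ∀ s t : ℝ≥0, s < t → ∀ A : Set ℝ, MeasurableSet A →
    μ⟦Y t ⁻¹' A | past Y s⟧ =ᵐ[μ] fun ω => (transitionLaw η θ s t (Y s ω)).real A

end BiPoisson

/-!
Why the theorem is true. Put `D_t(x, z) = 1 + (t η + θ - x) z + t (1 + η θ) z²` and let `p_n(·; t)`
(`mPoly`) be the monic polynomials with `∑ p_n(x; t) zⁿ = (1 + t η z) / D_t(x, z)`. Comparing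
generating functions, `Q_n(y; x, t, s)` for `n ≥ 1` is a combination of `p_n`, `p_{n-1}`, `p_{n-2}`
at `(y, t)` whose coefficients turn it into `0` when `(y, t)` is replaced by `(x, s)`. So
`∫ Q_n dν = 0` for all `n ≥ 1` says the same as `∫ p_n(y; t) ν(dy) = p_n(x; s)` for all `n`
(`integral_Q_eq_zero_iff`), and the theorem reduces to: `p_n(X_t; t)` is a martingale for each `n`.

Existence of `P_{s,t}(x, dy)`: it is the spectral measure, at the first basis vector, of a bounded
Jacobi operator on `ℓ²` (`exists_makesOrthogonal`); the off-diagonal entries are square roots of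
`(t - s)(1 + x η)` and `t (1 + η θ)`. Its support is compact, so its moments determine it among all
measures with finite moments (`eq_of_integral_polynomial_eq`), which gives uniqueness.

Martingale property (`condExp_mPoly_add_two`): suppose it holds up to degree `m + 1`. Computing
`E(X_t p_{m+1}(X_u; u) | 𝓕_s)` by conditioning first on `𝓕_t`, and then instead on `𝓖_{s,u}` with
the linear regression, shows that the defect of `p_{m+2}` at time `t` is `(t - s)/(u - s)` times the
defect at time `u`. The same computation for `E(X_t² p_m(X_u; u) | 𝓕_s)` with the conditional
second moment gives the factor `t (t - s)/(u (u - s))` instead; this is where the three-term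
recursion of the `p_n` has to match the conditional variance (`defect_quadratic`). As `t ≠ u`, both
defects vanish. The start of the induction, that `X` itself is a martingale, follows from the linear
regression and `E (X_u - X_s)² = u - s` by letting `u → ∞` (`condExp_past_eq`).

Moments: degree two needs only square-integrability and yields
`Var(X_t | 𝓕_s) = (t - s)(1 + η X_s)`, hence `1 + η X_s ≥ 0`. Since also `Var(X_s | 𝓖_{0,t})` grows
only linearly in `X_t`, moments of order `j + 1` give moments of order `j + 2`
(`integrable_pow_add_two`), so that all moments are finite. The conditional law of `X_t` given
`𝓕_s` then has the moments of `P_{s,t}(X_s, dy)` and is equal to it.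

Finite-dimensional distributions: integrals of polynomials against `P_{s,t}(x, dy)` are polynomials
in `x`, so by Weierstrass approximation the transition laws form a measurable kernel
(`measurable_stepLaw`), and the laws of the process at finitely many times are obtained by
composing these kernels, starting from the point mass at `0`.
-/

namespace BiPoisson


/-! ### The martingale polynomials -/

/-- The monic polynomials `p_n(·; t)` with generating function
`∑ p_n(x; t) zⁿ = (1 + t η z) / (1 + (t η + θ - x) z + t (1 + η θ) z²)`. They depend on a single
time parameter, and `t ↦ p_n(X_t; t)` turns out to be a martingale for every `n`. -/
noncomputable def mPoly (η θ t : ℝ) : ℕ → Polynomial ℝ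
  | 0 => 1
  | 1 => Polynomial.X - Polynomial.C θ
  | n + 2 => (Polynomial.X - Polynomial.C (t * η + θ)) * mPoly η θ t (n + 1)
      - Polynomial.C (t * (1 + η * θ)) * mPoly η θ t n

/-- Diagonal Jacobi coefficient of `mPoly`. -/
noncomputable def diagCoeff (η θ t : ℝ) (n : ℕ) : ℝ := if n = 0 then θ else t * η + θ

/-- Lower Jacobi coefficient of `mPoly`; it vanishes for `n = 0`, where `p_{n-1}` is junk. -/
noncomputable def lowCoeff (η θ t : ℝ) (n : ℕ) : ℝ := if n = 0 then 0 else t * (1 + η * θ)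

lemma X_mul_mPoly (η θ t : ℝ) (n : ℕ) :
    Polynomial.X * mPoly η θ t n = mPoly η θ t (n + 1)
      + Polynomial.C (diagCoeff η θ t n) * mPoly η θ t n
      + Polynomial.C (lowCoeff η θ t n) * mPoly η θ t (n - 1) := by
  rcases n with _ | n
  · simp [mPoly, diagCoeff, lowCoeff]
  · simp only [mPoly, diagCoeff, lowCoeff, Nat.add_sub_cancel, Nat.succ_ne_zero, if_false]
    ring

lemma mul_eval_mPoly (η θ t : ℝ) (n : ℕ) (x : ℝ) :
    x * (mPoly η θ t n).eval x = (mPoly η θ t (n + 1)).eval x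
      + diagCoeff η θ t n * (mPoly η θ t n).eval x
      + lowCoeff η θ t n * (mPoly η θ t (n - 1)).eval x := by
  have := congrArg (Polynomial.eval x) (X_mul_mPoly η θ t n)
  simpa using this

/-- Two applications of the three-term recursion. The indices `n - 1` and `n - 1 - 1` may be
truncated, in which case their coefficients vanish. -/
lemma sq_mul_eval_mPoly (η θ t : ℝ) (n : ℕ) (x : ℝ) :
    x ^ 2 * (mPoly η θ t n).eval x = (mPoly η θ t (n + 2)).eval x
      + (diagCoeff η θ t (n + 1) + diagCoeff η θ t n) * (mPoly η θ t (n + 1)).eval x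
      + (lowCoeff η θ t (n + 1) + diagCoeff η θ t n ^ 2 + lowCoeff η θ t n)
        * (mPoly η θ t n).eval x
      + lowCoeff η θ t n * (diagCoeff η θ t n + diagCoeff η θ t (n - 1))
        * (mPoly η θ t (n - 1)).eval x
      + lowCoeff η θ t n * lowCoeff η θ t (n - 1) * (mPoly η θ t (n - 1 - 1)).eval x := by
  have h0 := mul_eval_mPoly η θ t n x
  have h1 := mul_eval_mPoly η θ t (n + 1) x
  have h2 := mul_eval_mPoly η θ t (n - 1) x
  rcases n with _ | n
  · simp only [lowCoeff, if_true, Nat.add_sub_cancel] at *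
    linear_combination (x + diagCoeff η θ t 0) * h0 + h1
  · simp only [Nat.add_sub_cancel] at *
    linear_combination (x + diagCoeff η θ t (n + 1)) * h0 + h1 + lowCoeff η θ t (n + 1) * h2

/-- A submodule of `ℝ[X]` that contains all `p_n(·; t)` is everything. -/
lemma eq_top_of_mPoly_mem (η θ t : ℝ) (W : Submodule ℝ (Polynomial ℝ))
    (hW : ∀ n, mPoly η θ t n ∈ W) : W = ⊤ := by
  have key : ∀ k n, Polynomial.X ^ k * mPoly η θ t n ∈ W := by
    intro k
    induction k with
    | zero => intro n; simpa using hW n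
    | succ k ih =>
      intro n
      have : Polynomial.X ^ (k + 1) * mPoly η θ t n
          = Polynomial.X ^ k * mPoly η θ t (n + 1)
            + diagCoeff η θ t n • (Polynomial.X ^ k * mPoly η θ t n)
            + lowCoeff η θ t n • (Polynomial.X ^ k * mPoly η θ t (n - 1)) := by
        rw [pow_succ, mul_assoc, X_mul_mPoly, Polynomial.smul_eq_C_mul, Polynomial.smul_eq_C_mul]
        ring
      rw [this]
      exact W.add_mem (W.add_mem (ih _) (W.smul_mem _ (ih _))) (W.smul_mem _ (ih _))
  rw [eq_top_iff]
  rintro q -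
  rw [q.as_sum_range_C_mul_X_pow]
  refine W.sum_mem fun i _ => ?_
  rw [← Polynomial.smul_eq_C_mul]
  exact W.smul_mem _ (by simpa [mPoly] using key i 0)

/-- The polynomials `Q_n(·; x, t, s)` in terms of `p_n(·; t)`: the generating function of the
`Q_n` is `(1 + t η z) D_s(x, z) / D_t(y, z) - s η z`, where
`D_t(x, z) = 1 + (t η + θ - x) z + t (1 + η θ) z²`. -/
lemma Q_add_two_eq (η θ s t x : ℝ) (n : ℕ) :
    Q η θ s t x (n + 2) = mPoly η θ t (n + 2)
      + Polynomial.C (s * η + θ - x) * mPoly η θ t (n + 1)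
      + Polynomial.C (s * (1 + η * θ)) * mPoly η θ t n := by
  induction n using Nat.strong_induction_on with
  | _ n ih =>
    rcases n with _ | _ | n
    · simp only [Q, mPoly, map_sub, map_add, map_mul, map_one]
      ring
    · rw [show (0 + 1 + 2 : ℕ) = 0 + 3 from rfl, Q]
      rw [ih 0 (by norm_num)]
      simp only [Q, mPoly, map_sub, map_add, map_mul, map_one]
      ring
    · rw [show (n + 1 + 1 + 2 : ℕ) = (n + 1) + 3 from rfl, Q,
        show n + 1 + 2 = (n + 1) + 2 from rfl, ih (n + 1) (by omega),
        show n + 1 + 1 = n + 2 from rfl, ih n (by omega)]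
      simp only [mPoly, map_sub, map_add, map_mul, map_one]
      ring

lemma Q_one_eq (η θ s t x : ℝ) :
    Q η θ s t x 1 = mPoly η θ t 1 + Polynomial.C (θ - x) := by
  simp [Q, mPoly]

lemma mPoly_eval_add_two (η θ s x : ℝ) (n : ℕ) :
    (mPoly η θ s (n + 2)).eval x + (s * η + θ - x) * (mPoly η θ s (n + 1)).eval x
      + s * (1 + η * θ) * (mPoly η θ s n).eval x = 0 := by
  simp [mPoly]
  ring

lemma integrable_eval {ν : Measure ℝ} (h : ∀ n : ℕ, Integrable (fun y : ℝ => y ^ n) ν)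
    (q : Polynomial ℝ) : Integrable (fun y => q.eval y) ν := by
  simp only [Polynomial.eval_eq_sum_range]
  exact integrable_finsetSum _ fun i _ => (h i).const_mul _

/-- For a probability measure with moments, `∫ Q_n dν = 0` for all `n ≥ 1` is the same as
`∫ p_n(y; t) ν(dy) = p_n(x; s)` for all `n`. -/
lemma integral_Q_eq_zero_iff {η θ s t x : ℝ} {ν : Measure ℝ} [IsProbabilityMeasure ν]
    (h : ∀ n : ℕ, Integrable (fun y : ℝ => y ^ n) ν) :
    (∀ n, ∫ y, (Q η θ s t x (n + 1)).eval y ∂ν = 0) ↔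
      ∀ n, ∫ y, (mPoly η θ t n).eval y ∂ν = (mPoly η θ s n).eval x := by
  have hi := integrable_eval h
  have e2 : ∀ n, ∫ y, (Q η θ s t x (n + 2)).eval y ∂ν = ∫ y, (mPoly η θ t (n + 2)).eval y ∂ν
      + (s * η + θ - x) * ∫ y, (mPoly η θ t (n + 1)).eval y ∂ν
      + s * (1 + η * θ) * ∫ y, (mPoly η θ t n).eval y ∂ν := by
    intro n
    simp only [Q_add_two_eq, Polynomial.eval_add, Polynomial.eval_mul, Polynomial.eval_C]
    rw [integral_add, integral_add, integral_const_mul, integral_const_mul]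
    · exact hi _
    · exact (hi _).const_mul _
    · exact (hi _).add ((hi _).const_mul _)
    · exact (hi _).const_mul _
  have e1 : ∫ y, (Q η θ s t x 1).eval y ∂ν = ∫ y, (mPoly η θ t 1).eval y ∂ν + (θ - x) := by
    simp only [Q_one_eq, Polynomial.eval_add, Polynomial.eval_C]
    rw [integral_add (hi _) (integrable_const _)]
    simp
  have z1 : (mPoly η θ s 1).eval x = x - θ := by simp [mPoly]
  constructor
  · intro hQ n
    induction n using Nat.strong_induction_on with
    | _ n ih =>
      rcases n with _ | _ | n
      · simp [mPoly]
      · have := hQ 0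
        simp only [zero_add] at this ⊢
        rw [e1] at this
        rw [z1]; linarith
      · have := hQ (n + 1)
        rw [e2, ih n (by omega), ih (n + 1) (by omega)] at this
        have z := mPoly_eval_add_two η θ s x n
        linarith
  · intro hp n
    rcases n with _ | n
    · rw [zero_add, e1, hp, z1]; ring
    · rw [e2, hp, hp, hp]
      exact mPoly_eval_add_two η θ s x n


/-! ### Moment determinacy -/

lemma integrable_pow_of_support {ν : Measure ℝ} [IsFiniteMeasure ν] {R : ℝ}
    (hR : ν (Set.Icc (-R) R)ᶜ = 0) (n : ℕ) : Integrable (fun y : ℝ => y ^ n) ν := by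
  have hae : ∀ᵐ y ∂ν, y ∈ Set.Icc (-R) R := by
    rw [ae_iff]; simpa [Set.compl_def] using hR
  refine Integrable.of_bound (by fun_prop) (R ^ n) ?_
  filter_upwards [hae] with y hy
  rw [norm_pow]
  exact pow_le_pow_left₀ (norm_nonneg _) (abs_le.mpr hy) n

/-- The moments of a measure control its support. -/
lemma support_of_integral_polynomial_eq {ν₁ ν₂ : Measure ℝ} [IsProbabilityMeasure ν₁]
    [IsProbabilityMeasure ν₂] {R : ℝ} (hR : ν₁ (Set.Icc (-R) R)ᶜ = 0)
    (h₂ : ∀ n : ℕ, Integrable (fun y : ℝ => y ^ n) ν₂)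
    (h : ∀ q : Polynomial ℝ, ∫ y, q.eval y ∂ν₁ = ∫ y, q.eval y ∂ν₂) :
    ν₂ (Set.Icc (-R) R)ᶜ = 0 := by
  have hae : ∀ᵐ y ∂ν₁, y ∈ Set.Icc (-R) R := by
    rw [ae_iff]; simpa [Set.compl_def] using hR
  have hR0 : 0 ≤ R := by
    obtain ⟨y, hy⟩ := hae.exists
    have := hy.1.trans hy.2
    linarith
  have hmom : ∀ n : ℕ, ∫ y, y ^ (2 * n) ∂ν₂ ≤ R ^ (2 * n) := by
    intro n
    have := h (Polynomial.X ^ (2 * n))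
    simp only [Polynomial.eval_pow, Polynomial.eval_X] at this
    rw [← this]
    calc ∫ y, y ^ (2 * n) ∂ν₁ ≤ ∫ y, R ^ (2 * n) ∂ν₁ := by
          refine integral_mono_ae (integrable_pow_of_support hR _) (integrable_const _) ?_
          filter_upwards [hae] with y hy
          show y ^ (2 * n) ≤ R ^ (2 * n)
          rw [← (even_two_mul n).pow_abs]
          exact pow_le_pow_left₀ (abs_nonneg y) (abs_le.mpr hy) _
      _ = _ := by simp
  have hset : (Set.Icc (-R) R)ᶜ ⊆ ⋃ k : ℕ, {y : ℝ | R + 1 / ((k : ℝ) + 1) ≤ |y|} := by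
    intro y hy
    have hy' : R < |y| := by
      by_contra hcon
      exact hy (abs_le.mp (not_lt.mp hcon))
    obtain ⟨k, hk⟩ := exists_nat_one_div_lt (sub_pos.mpr hy')
    refine Set.mem_iUnion.mpr ⟨k, ?_⟩
    show R + 1 / ((k : ℝ) + 1) ≤ |y|
    linarith
  refine measure_mono_null hset (measure_iUnion_null fun k => ?_)
  set r : ℝ := R + 1 / ((k : ℝ) + 1) with hr
  have hrR : R < r := by have : (0 : ℝ) < 1 / ((k : ℝ) + 1) := by positivity
                         linarith
  have hr0 : 0 < r := hR0.trans_lt hrR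
  have hbound : ∀ n : ℕ, ν₂.real {y : ℝ | r ≤ |y|} ≤ ((R / r) ^ 2) ^ n := by
    intro n
    have hm := mul_meas_ge_le_integral_of_nonneg (μ := ν₂) (f := fun y : ℝ => y ^ (2 * n))
      (Filter.Eventually.of_forall fun y => (even_two_mul n).pow_nonneg y) (h₂ _) (r ^ (2 * n))
    have hsub : ν₂.real {y : ℝ | r ≤ |y|} ≤ ν₂.real {y : ℝ | r ^ (2 * n) ≤ y ^ (2 * n)} := by
      refine measureReal_mono ?_
      intro y (hy : r ≤ |y|)
      show r ^ (2 * n) ≤ y ^ (2 * n)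
      rw [← (even_two_mul n).pow_abs y]
      exact pow_le_pow_left₀ hr0.le hy _
    have hp : 0 < r ^ (2 * n) := by positivity
    rw [← pow_mul, div_pow, le_div_iff₀ hp, mul_comm]
    exact (mul_le_mul_of_nonneg_left hsub hp.le).trans (hm.trans (hmom n))
  have hlim : Filter.Tendsto (fun n : ℕ => ((R / r) ^ 2) ^ n) Filter.atTop (nhds 0) := by
    refine tendsto_pow_atTop_nhds_zero_of_lt_one (by positivity) ?_
    rw [sq_lt_one_iff_abs_lt_one, abs_of_nonneg (by positivity), div_lt_one hr0]
    exact hrR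
  have hle : ν₂.real {y : ℝ | r ≤ |y|} ≤ 0 := ge_of_tendsto' hlim hbound
  rw [← measureReal_eq_zero_iff]
  exact le_antisymm hle measureReal_nonneg

lemma abs_integral_sub_le_of_support {ν : Measure ℝ} [IsProbabilityMeasure ν] {R ε : ℝ}
    (hR : ν (Set.Icc (-R) R)ᶜ = 0) {f g : ℝ → ℝ} (hf : Integrable f ν) (hg : Integrable g ν)
    (hfg : ∀ y ∈ Set.Icc (-R) R, |f y - g y| < ε) :
    |∫ y, f y ∂ν - ∫ y, g y ∂ν| ≤ ε := by
  have hae : ∀ᵐ y ∂ν, y ∈ Set.Icc (-R) R := by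
    rw [ae_iff]; simpa [Set.compl_def] using hR
  rw [← integral_sub hf hg, ← Real.norm_eq_abs]
  have := norm_integral_le_of_norm_le_const (μ := ν) (f := fun y => f y - g y) (C := ε)
    (by filter_upwards [hae] with y hy; exact (hfg y hy).le)
  simpa using this

/-- A compactly supported probability measure is determined by its moments. -/
lemma eq_of_integral_polynomial_eq {ν₁ ν₂ : Measure ℝ} [IsProbabilityMeasure ν₁]
    [IsProbabilityMeasure ν₂] {R : ℝ} (hR : ν₁ (Set.Icc (-R) R)ᶜ = 0)
    (h₂ : ∀ n : ℕ, Integrable (fun y : ℝ => y ^ n) ν₂)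
    (h : ∀ q : Polynomial ℝ, ∫ y, q.eval y ∂ν₁ = ∫ y, q.eval y ∂ν₂) : ν₂ = ν₁ := by
  have hR₂ := support_of_integral_polynomial_eq hR h₂ h
  refine ext_of_forall_integral_eq_of_IsFiniteMeasure fun f => ?_
  refine eq_of_forall_dist_le fun ε hε => ?_
  rw [Real.dist_eq]
  obtain ⟨q, hq⟩ := exists_polynomial_near_of_continuousOn (-R) R f f.continuous.continuousOn
    (ε / 2) (by positivity)
  have e₁ := abs_integral_sub_le_of_support hR
    (integrable_eval (integrable_pow_of_support hR) q) (f.integrable ν₁) hq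
  have e₂ := abs_integral_sub_le_of_support hR₂ (integrable_eval h₂ q) (f.integrable ν₂) hq
  rw [h q] at e₁
  rw [abs_le] at *
  constructor <;> linarith [e₁.1, e₁.2, e₂.1, e₂.2]


/-! ### Existence: the spectral measure of a Jacobi operator -/

open scoped CompactlySupported in
/-- The spectral measure of a bounded self-adjoint operator `T` at a unit vector `e`. -/
lemma exists_spectralMeasure {H : Type*} [NormedAddCommGroup H] [InnerProductSpace ℂ H]
    [CompleteSpace H] (T : H →L[ℂ] H) (hT : IsSelfAdjoint T) (e : H) (he : ‖e‖ = 1) :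
    ∃ ν : Measure ℝ, IsProbabilityMeasure ν ∧ (∃ R : ℝ, ν (Set.Icc (-R) R)ᶜ = 0) ∧
      ∀ q : Polynomial ℝ, ∫ y, q.eval y ∂ν = (inner ℂ e (Polynomial.aeval T q e)).re := by
  let L : C(spectrum ℝ T, ℝ) →ₗ[ℝ] ℝ :=
    { toFun := fun f => (inner ℂ e (cfcHom hT f e)).re
      map_add' := fun f g => by simp
      map_smul' := fun c f => by
        simp [inner_smul_right_eq_smul] }
  have hL : ∀ f : C(spectrum ℝ T, ℝ), 0 ≤ f → 0 ≤ L f := by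
    intro f hf
    let g : C(spectrum ℝ T, ℝ) := ⟨fun x => Real.sqrt (f x), by fun_prop⟩
    have hg : f = star g * g := by
      ext x
      have hfx : 0 ≤ f x := hf x
      simp [g, Real.mul_self_sqrt hfx]
    have : L f = (inner ℂ e ((star (cfcHom hT g) * cfcHom hT g) e)).re := by
      show (inner ℂ e (cfcHom hT f e)).re = _
      rw [hg, map_mul, map_star]
    rw [this, ContinuousLinearMap.star_eq_adjoint, mul_apply_eq_comp,
      ContinuousLinearMap.adjoint_inner_right]
    exact inner_self_nonneg (𝕜 := ℂ)
  let Λ : C_c(spectrum ℝ T, ℝ) →ₚ[ℝ] ℝ := PositiveLinearMap.mk₀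
    { toFun := fun f => L f.toContinuousMap
      map_add' := fun f g => L.map_add f.toContinuousMap g.toContinuousMap
      map_smul' := fun c f => L.map_smul c f.toContinuousMap }
    (fun f hf => hL f.toContinuousMap fun x => hf x)
  have : CompactSpace (spectrum ℝ T) := isCompact_iff_compactSpace.mp (spectrum.isCompact T)
  have hΛ : ∀ f : C(spectrum ℝ T, ℝ), ∫ x, f x ∂(RealRMK.rieszMeasure Λ) = L f := fun f =>
    RealRMK.integral_rieszMeasure Λ (CompactlySupportedContinuousMap.continuousMapEquiv f)
  have hfin : IsFiniteMeasure (RealRMK.rieszMeasure Λ) := inferInstance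
  have hone : L 1 = 1 := by
    show (inner ℂ e (cfcHom hT 1 e)).re = 1
    rw [map_one]
    simp [inner_self_eq_norm_sq_to_K, he]
  have hprob : IsProbabilityMeasure (RealRMK.rieszMeasure Λ) := by
    have := hΛ 1
    simp only [ContinuousMap.one_apply, integral_const, smul_eq_mul, mul_one] at this
    rw [hone] at this
    exact isProbabilityMeasure_iff_real.mpr this
  refine ⟨(RealRMK.rieszMeasure Λ).map Subtype.val,
    Measure.isProbabilityMeasure_map measurable_subtype_coe.aemeasurable, ?_, ?_⟩
  · obtain ⟨R, hR⟩ := (spectrum.isCompact (𝕜 := ℝ) T).isBounded.subset_closedBall 0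
    refine ⟨R, ?_⟩
    rw [Measure.map_apply measurable_subtype_coe measurableSet_Icc.compl]
    convert measure_empty (μ := RealRMK.rieszMeasure Λ)
    ext x
    have := hR x.2
    simpa [Real.closedBall_eq_Icc] using this
  · intro q
    rw [integral_map measurable_subtype_coe.aemeasurable (by fun_prop)]
    have := hΛ (q.toContinuousMapOn _)
    simp only [Polynomial.toContinuousMapOn_apply, Polynomial.toContinuousMap_apply] at this
    rw [this]
    show (inner ℂ e (cfcHom hT (q.toContinuousMapOn _) e)).re = _
    have hpoly : (((cfcHom hT : C(spectrum ℝ T, ℝ) →⋆ₐ[ℝ] (H →L[ℂ] H)) :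
        C(spectrum ℝ T, ℝ) →ₐ[ℝ] (H →L[ℂ] H))).comp
        (Polynomial.toContinuousMapOnAlgHom (spectrum ℝ T)) = Polynomial.aeval T := by
      refine Polynomial.algHom_ext ?_
      simp only [AlgHom.comp_apply, Polynomial.toContinuousMapOnAlgHom_apply,
        Polynomial.toContinuousMapOn_X_eq_restrict_id, Polynomial.aeval_X]
      exact cfcHom_id hT
    rw [← hpoly]
    rfl

/-- The unilateral shift on a Hilbert space with an orthonormal basis indexed by `ℕ`, with the
action of its adjoint. -/
lemma exists_shift {H : Type*} [NormedAddCommGroup H] [InnerProductSpace ℂ H] [CompleteSpace H]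
    (b : HilbertBasis ℕ ℂ H) : ∃ S : H →L[ℂ] H, (∀ n, S (b n) = b (n + 1)) ∧
      star S (b 0) = 0 ∧ ∀ n, star S (b (n + 1)) = b n := by
  have ho : Orthonormal ℂ fun n => b (n + 1) := b.orthonormal.comp _ (add_left_injective 1)
  let S : H →L[ℂ] H := (ho.orthogonalFamily.linearIsometry.comp
    b.repr.toLinearIsometry).toContinuousLinearMap
  have hS : ∀ n, S (b n) = b (n + 1) := by
    intro n
    show ho.orthogonalFamily.linearIsometry (b.repr (b n)) = _
    rw [b.repr_self, OrthogonalFamily.linearIsometry_apply_single]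
    simp
  have hite := orthonormal_iff_ite.mp b.orthonormal
  refine ⟨S, hS, ?_, fun n => ?_⟩
  all_goals
    apply b.repr.injective
    ext j
    rw [b.repr_apply_apply, b.repr_apply_apply, ContinuousLinearMap.star_eq_adjoint,
      ContinuousLinearMap.adjoint_inner_right, hS, hite]
  · simp
  · rw [hite]; simp

/-- The Jacobi operator with diagonal `b₀, b₁, β, β, …` and off-diagonal `α, γ, γ, …`: a finite
rank perturbation of `β + γ (S + S*)`, where `S` is the shift. -/
lemma exists_jacobiOperator {H : Type*} [NormedAddCommGroup H] [InnerProductSpace ℂ H]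
    [CompleteSpace H] (b : HilbertBasis ℕ ℂ H) (b₀ b₁ β α γ : ℝ) :
    ∃ T : H →L[ℂ] H, IsSelfAdjoint T ∧ T (b 0) = b₀ • b 0 + α • b 1 ∧
      T (b 1) = α • b 0 + b₁ • b 1 + γ • b 2 ∧
      ∀ n, T (b (n + 2)) = γ • b (n + 1) + β • b (n + 2) + γ • b (n + 3) := by
  have hite := orthonormal_iff_ite.mp b.orthonormal
  obtain ⟨S, hS, hS0, hS1⟩ := exists_shift b
  let r : ℕ → ℕ → H →L[ℂ] H :=
    fun i j => InnerProductSpace.rankOne ℂ (b i) (b j)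
  have hr : ∀ i j, star (r i j) = r j i := fun i j => by
    rw [ContinuousLinearMap.star_eq_adjoint, InnerProductSpace.adjoint_rankOne]
  have hrb : ∀ i j k, r i j (b k) = if j = k then b i else 0 := by
    intro i j k
    show inner ℂ (b j) (b k) • b i = _
    rw [hite]
    split_ifs <;> simp
  refine ⟨β • 1 + γ • (S + star S) + (b₀ - β) • r 0 0 + (b₁ - β) • r 1 1
    + (α - γ) • (r 0 1 + r 1 0), ?_, ?_, ?_, fun n => ?_⟩
  · rw [IsSelfAdjoint]
    simp only [star_add, star_smul, star_one, star_star, hr, star_trivial, add_comm (star S) S,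
      add_comm (r 1 0) (r 0 1)]
  · simp [hrb, hS, hS0]
    module
  · simp [hrb, hS, hS1 0]
    module
  · have h1 := hS1 (n + 1)
    simp [hrb, hS, h1]
    module

/-- `Q_n` evaluated at the Jacobi operator sends `e_0` to a multiple of `e_n`. -/
lemma exists_aeval_Q_eq {H : Type*} [NormedAddCommGroup H] [InnerProductSpace ℂ H]
    {T : H →L[ℂ] H} {e : ℕ → H} {η θ s t x α γ : ℝ} (hα : α ^ 2 = (t - s) * (1 + x * η))
    (hγ : γ ^ 2 = t * (1 + η * θ)) (h0 : T (e 0) = x • e 0 + α • e 1)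
    (h1 : T (e 1) = α • e 0 + ((t - s) * η + θ) • e 1 + γ • e 2)
    (h2 : ∀ n, T (e (n + 2)) = γ • e (n + 1) + (t * η + θ) • e (n + 2) + γ • e (n + 3)) (n : ℕ) :
    ∃ w : ℝ, Polynomial.aeval T (Q η θ s t x n) (e 0) = w • e n := by
  have key : ∀ n, Polynomial.aeval T (Q η θ s t x (n + 1)) (e 0) = (α * γ ^ n) • e (n + 1) := by
    intro n
    induction n using Nat.strong_induction_on with
    | _ n ih =>
      rcases n with _ | _ | n
      · simp [Q, h0, Algebra.algebraMap_eq_smul_one]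
      · simp [Q, h0, h1, Algebra.algebraMap_eq_smul_one, ← hα]
        module
      · have e1 := ih n (by omega)
        have e2 := ih (n + 1) (by omega)
        rw [show n + 1 + 1 + 1 = n + 3 from rfl, Q]
        rw [show n + 1 + 1 = n + 2 from rfl] at e2 ⊢
        simp only [map_sub, map_mul, Polynomial.aeval_X, Polynomial.aeval_C,
          Algebra.algebraMap_eq_smul_one, sub_apply, mul_apply_eq_comp,
          ← hγ]
        simp only [smul_apply, one_apply_eq_self, e1, e2, T.map_smul_of_tower, h2]
        module
  rcases n with _ | n
  · exact ⟨1, by simp [Q]⟩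
  · exact ⟨_, key n⟩

lemma isSelfAdjoint_aeval {H : Type*} [NormedAddCommGroup H] [InnerProductSpace ℂ H]
    [CompleteSpace H] {T : H →L[ℂ] H} (hT : IsSelfAdjoint T) (q : Polynomial ℝ) :
    IsSelfAdjoint (Polynomial.aeval T q) := by
  induction q using Polynomial.induction_on' with
  | add p q hp hq => rw [map_add]; exact hp.add hq
  | monomial n a =>
    rw [Polynomial.aeval_monomial, Algebra.algebraMap_eq_smul_one, smul_mul_assoc, one_mul]
    exact (IsSelfAdjoint.all a).smul (hT.pow n)

lemma inner_aeval_Q_mul_eq_zero {H : Type*} [NormedAddCommGroup H] [InnerProductSpace ℂ H]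
    [CompleteSpace H] {T : H →L[ℂ] H} (hT : IsSelfAdjoint T) {e : ℕ → H} (he : Orthonormal ℂ e)
    {η θ s t x α γ : ℝ} (hα : α ^ 2 = (t - s) * (1 + x * η))
    (hγ : γ ^ 2 = t * (1 + η * θ)) (h0 : T (e 0) = x • e 0 + α • e 1)
    (h1 : T (e 1) = α • e 0 + ((t - s) * η + θ) • e 1 + γ • e 2)
    (h2 : ∀ n, T (e (n + 2)) = γ • e (n + 1) + (t * η + θ) • e (n + 2) + γ • e (n + 3))
    {m n : ℕ} (hmn : m ≠ n) :
    inner ℂ (e 0) (Polynomial.aeval T (Q η θ s t x m * Q η θ s t x n) (e 0)) = 0 := by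
  obtain ⟨w, hw⟩ := exists_aeval_Q_eq hα hγ h0 h1 h2 m
  obtain ⟨w', hw'⟩ := exists_aeval_Q_eq hα hγ h0 h1 h2 n
  rw [map_mul, mul_apply_eq_comp, hw', ← ContinuousLinearMap.adjoint_inner_left,
    ← ContinuousLinearMap.star_eq_adjoint, (isSelfAdjoint_aeval hT _).star_eq, hw]
  simp [inner_smul_left_eq_smul, inner_smul_right_eq_smul, he.2 hmn]

/-- The transition laws exist and have compact support. -/
lemma exists_makesOrthogonal {η θ s t x : ℝ} (hηθ : 0 ≤ 1 + η * θ) (hs : 0 ≤ s) (hst : s < t)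
    (hx : 0 ≤ 1 + x * η) :
    ∃ ν : Measure ℝ, MakesOrthogonal (Q η θ s t x) ν ∧ ∃ R : ℝ, ν (Set.Icc (-R) R)ᶜ = 0 := by
  let b : HilbertBasis ℕ ℂ (lp (fun _ : ℕ => ℂ) 2) :=
    HilbertBasis.ofRepr (LinearIsometryEquiv.refl ℂ _)
  obtain ⟨T, hT, h0, h1, h2⟩ := exists_jacobiOperator b x ((t - s) * η + θ) (t * η + θ)
    (Real.sqrt ((t - s) * (1 + x * η))) (Real.sqrt (t * (1 + η * θ)))
  obtain ⟨ν, hν, ⟨R, hR⟩, hint⟩ := exists_spectralMeasure T hT (b 0) (b.orthonormal.1 0)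
  refine ⟨ν, ⟨hν, fun n => integrable_pow_of_support hR n, fun m n hmn => ?_⟩, R, hR⟩
  have := hint (Q η θ s t x m * Q η θ s t x n)
  simp only [Polynomial.eval_mul] at this
  rw [this, inner_aeval_Q_mul_eq_zero hT b.orthonormal
    (Real.sq_sqrt (mul_nonneg (sub_nonneg.mpr hst.le) hx))
    (Real.sq_sqrt (mul_nonneg (hs.trans hst.le) hηθ)) h0 h1 h2 hmn, Complex.zero_re]


/-! ### The transition laws -/

lemma MakesOrthogonal.integral_mPoly {η θ s t x : ℝ} {ν : Measure ℝ}
    (h : MakesOrthogonal (Q η θ s t x) ν) (n : ℕ) :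
    ∫ y, (mPoly η θ t n).eval y ∂ν = (mPoly η θ s n).eval x := by
  have := h.isProbabilityMeasure
  refine (integral_Q_eq_zero_iff h.integrable_pow).mp (fun n => ?_) n
  have := h.orthogonal (n + 1) 0 (by omega)
  simpa [Q] using this

/-- Two measures for which all `∫ p_n(y; t) ν(dy)` agree have the same moments. -/
lemma integral_polynomial_eq_of_mPoly (η θ t : ℝ) {ν₁ ν₂ : Measure ℝ}
    (h₁ : ∀ n : ℕ, Integrable (fun y : ℝ => y ^ n) ν₁)
    (h₂ : ∀ n : ℕ, Integrable (fun y : ℝ => y ^ n) ν₂)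
    (h : ∀ n, ∫ y, (mPoly η θ t n).eval y ∂ν₁ = ∫ y, (mPoly η θ t n).eval y ∂ν₂)
    (q : Polynomial ℝ) : ∫ y, q.eval y ∂ν₁ = ∫ y, q.eval y ∂ν₂ := by
  let W : Submodule ℝ (Polynomial ℝ) :=
    { carrier := {q | ∫ y, q.eval y ∂ν₁ = ∫ y, q.eval y ∂ν₂}
      add_mem' := fun {p q} hp hq => by
        simp only [Set.mem_ofPred_eq, Polynomial.eval_add] at *
        rw [integral_add (integrable_eval h₁ p) (integrable_eval h₁ q),
          integral_add (integrable_eval h₂ p) (integrable_eval h₂ q), hp, hq]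
      zero_mem' := by simp
      smul_mem' := fun c q hq => by
        simp only [Set.mem_ofPred_eq, Polynomial.eval_smul, smul_eq_mul, integral_const_mul] at *
        rw [hq] }
  have : q ∈ W := by rw [eq_top_of_mPoly_mem η θ t W h]; trivial
  exact this

/-- A measure that makes the `Q_n` orthogonal is equal to every probability measure with
`∫ p_n(y; t) ν(dy) = p_n(x; s)` for all `n`. -/
lemma eq_of_integral_mPoly {η θ s t x : ℝ} (hηθ : 0 ≤ 1 + η * θ) (hs : 0 ≤ s) (hst : s < t)
    (hx : 0 ≤ 1 + x * η) {ν₁ ν₂ : Measure ℝ} (h₁ : MakesOrthogonal (Q η θ s t x) ν₁)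
    [IsProbabilityMeasure ν₂] (h₂ : ∀ n : ℕ, Integrable (fun y : ℝ => y ^ n) ν₂)
    (h : ∀ n, ∫ y, (mPoly η θ t n).eval y ∂ν₂ = (mPoly η θ s n).eval x) : ν₁ = ν₂ := by
  obtain ⟨ν, hν, R, hR⟩ := exists_makesOrthogonal hηθ hs hst hx
  have i₀ := hν.isProbabilityMeasure
  have i₁ := h₁.isProbabilityMeasure
  rw [eq_of_integral_polynomial_eq hR h₁.integrable_pow (integral_polynomial_eq_of_mPoly η θ t
      hν.integrable_pow h₁.integrable_pow fun n => by
        rw [hν.integral_mPoly, h₁.integral_mPoly]),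
    eq_of_integral_polynomial_eq hR h₂ (integral_polynomial_eq_of_mPoly η θ t
      hν.integrable_pow h₂ fun n => by rw [hν.integral_mPoly, h])]

lemma existsUnique_makesOrthogonal {η θ s t x : ℝ} (hηθ : 0 ≤ 1 + η * θ) (hs : 0 ≤ s)
    (hst : s < t) (hx : 0 ≤ 1 + x * η) :
    ∃! ν : Measure ℝ, MakesOrthogonal (Q η θ s t x) ν := by
  obtain ⟨ν, hν, -⟩ := exists_makesOrthogonal hηθ hs hst hx
  refine ⟨ν, hν, fun ν' hν' => ?_⟩
  have := hν.isProbabilityMeasure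
  exact eq_of_integral_mPoly hηθ hs hst hx hν' hν.integrable_pow hν.integral_mPoly

lemma makesOrthogonal_transitionLaw {η θ s t x : ℝ} (hηθ : 0 ≤ 1 + η * θ) (hs : 0 ≤ s)
    (hst : s < t) (hx : 0 ≤ 1 + x * η) :
    MakesOrthogonal (Q η θ s t x) (transitionLaw η θ s t x) := by
  have h := (existsUnique_makesOrthogonal hηθ hs hst hx).exists
  rw [transitionLaw, dif_pos h]
  exact h.choose_spec

lemma exists_support_transitionLaw {η θ s t x : ℝ} (hηθ : 0 ≤ 1 + η * θ) (hs : 0 ≤ s)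
    (hst : s < t) (hx : 0 ≤ 1 + x * η) :
    ∃ R : ℝ, transitionLaw η θ s t x (Set.Icc (-R) R)ᶜ = 0 := by
  obtain ⟨ν, hν, R, hR⟩ := exists_makesOrthogonal hηθ hs hst hx
  refine ⟨R, ?_⟩
  rwa [(existsUnique_makesOrthogonal hηθ hs hst hx).unique
    (makesOrthogonal_transitionLaw hηθ hs hst hx) hν]

open Classical in
/-- The transition law on the state space `{x | 1 + x η ≥ 0}`, extended by a point mass to all
starting points, as a family of probability measures. -/
noncomputable def stepLaw (η θ s t x : ℝ) : Measure ℝ :=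
  if 0 ≤ 1 + x * η then transitionLaw η θ s t x else Measure.dirac 0

lemma stepLaw_of_mem {η θ s t x : ℝ} (hx : 0 ≤ 1 + x * η) :
    stepLaw η θ s t x = transitionLaw η θ s t x := if_pos hx

lemma stepLaw_of_notMem {η θ s t x : ℝ} (hx : ¬ 0 ≤ 1 + x * η) :
    stepLaw η θ s t x = Measure.dirac 0 := if_neg hx

lemma isProbabilityMeasure_stepLaw {η θ s t : ℝ} (hηθ : 0 ≤ 1 + η * θ) (hs : 0 ≤ s)
    (hst : s < t) (x : ℝ) : IsProbabilityMeasure (stepLaw η θ s t x) := by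
  by_cases hx : 0 ≤ 1 + x * η
  · rw [stepLaw_of_mem hx]
    exact (makesOrthogonal_transitionLaw hηθ hs hst hx).isProbabilityMeasure
  · rw [stepLaw_of_notMem hx]
    infer_instance

lemma integrable_pow_stepLaw {η θ s t : ℝ} (hηθ : 0 ≤ 1 + η * θ) (hs : 0 ≤ s)
    (hst : s < t) (x : ℝ) (n : ℕ) : Integrable (fun y : ℝ => y ^ n) (stepLaw η θ s t x) := by
  by_cases hx : 0 ≤ 1 + x * η
  · rw [stepLaw_of_mem hx]
    exact (makesOrthogonal_transitionLaw hηθ hs hst hx).integrable_pow n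
  · rw [stepLaw_of_notMem hx]
    exact integrable_dirac (by simp)

lemma exists_support_stepLaw {η θ s t : ℝ} (hηθ : 0 ≤ 1 + η * θ) (hs : 0 ≤ s)
    (hst : s < t) (x : ℝ) : ∃ R : ℝ, stepLaw η θ s t x (Set.Icc (-R) R)ᶜ = 0 := by
  by_cases hx : 0 ≤ 1 + x * η
  · rw [stepLaw_of_mem hx]
    exact exists_support_transitionLaw hηθ hs hst hx
  · rw [stepLaw_of_notMem hx]
    exact ⟨1, by rw [Measure.dirac_apply' _ measurableSet_Icc.compl]; simp⟩

lemma measurableSet_stateSpace (η : ℝ) : MeasurableSet {x : ℝ | 0 ≤ 1 + x * η} :=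
  measurableSet_le measurable_const (by fun_prop)

/-- Integrals of polynomials depend measurably on the starting point: for `p_n(·; t)` the integral
is `p_n(x; s)`. -/
lemma measurable_integral_polynomial_stepLaw {η θ s t : ℝ} (hηθ : 0 ≤ 1 + η * θ) (hs : 0 ≤ s)
    (hst : s < t) (q : Polynomial ℝ) : Measurable fun x => ∫ y, q.eval y ∂stepLaw η θ s t x := by
  have hi := fun x => integrable_eval (integrable_pow_stepLaw hηθ hs hst x)
  let W : Submodule ℝ (Polynomial ℝ) :=
    { carrier := {q | Measurable fun x => ∫ y, q.eval y ∂stepLaw η θ s t x}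
      add_mem' := fun {p q} hp hq => by
        simp only [Set.mem_ofPred_eq, Polynomial.eval_add] at *
        simp_rw [integral_add (hi _ p) (hi _ q)]
        exact hp.add hq
      zero_mem' := by simp
      smul_mem' := fun c q hq => by
        simp only [Set.mem_ofPred_eq, Polynomial.eval_smul, smul_eq_mul, integral_const_mul] at *
        exact hq.const_mul c }
  have hW : ∀ n, mPoly η θ t n ∈ W := by
    intro n
    classical
    have : (fun x => ∫ y, (mPoly η θ t n).eval y ∂stepLaw η θ s t x) = fun x =>
        if 0 ≤ 1 + x * η then (mPoly η θ s n).eval x else (mPoly η θ t n).eval 0 := by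
      funext x
      split_ifs with hx
      · rw [stepLaw_of_mem hx]
        exact (makesOrthogonal_transitionLaw hηθ hs hst hx).integral_mPoly n
      · rw [stepLaw_of_notMem hx, integral_dirac]
    show Measurable _
    rw [this]
    exact Measurable.ite (measurableSet_stateSpace η) (by fun_prop) measurable_const
  have : q ∈ W := by rw [eq_top_of_mPoly_mem η θ t W hW]; trivial
  exact this

/-- The same for bounded continuous `f`. Polynomials `q_N` within `1 / (N + 1)` of `f` on `[-N, N]`
have integrals that converge pointwise in `x`, as every transition law has compact support. -/
lemma measurable_integral_stepLaw {η θ s t : ℝ} (hηθ : 0 ≤ 1 + η * θ) (hs : 0 ≤ s)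
    (hst : s < t) (f : BoundedContinuousFunction ℝ ℝ) :
    Measurable fun x => ∫ y, f y ∂stepLaw η θ s t x := by
  choose q hq using fun N : ℕ => exists_polynomial_near_of_continuousOn (-(N : ℝ)) N f
    f.continuous.continuousOn (1 / ((N : ℝ) + 1)) (by positivity)
  refine measurable_of_tendsto_metrizable
    (fun N => measurable_integral_polynomial_stepLaw hηθ hs hst (q N)) ?_
  rw [tendsto_pi_nhds]
  intro x
  have := isProbabilityMeasure_stepLaw hηθ hs hst x
  obtain ⟨R, hR⟩ := exists_support_stepLaw hηθ hs hst x
  rw [tendsto_iff_dist_tendsto_zero]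
  refine squeeze_zero' (Filter.Eventually.of_forall fun _ => dist_nonneg) ?_
    tendsto_one_div_add_atTop_nhds_zero_nat
  filter_upwards [Filter.eventually_ge_atTop ⌈R⌉₊] with N hN
  have hRN : R ≤ N := (Nat.le_ceil R).trans (by exact_mod_cast hN)
  refine abs_integral_sub_le_of_support (measure_mono_null ?_ hR)
    (integrable_eval (integrable_pow_stepLaw hηθ hs hst x) (q N)) (f.integrable _) (hq N)
  exact Set.compl_subset_compl.mpr (Set.Icc_subset_Icc (by linarith) hRN)

lemma measurable_stepLaw {η θ s t : ℝ} (hηθ : 0 ≤ 1 + η * θ) (hs : 0 ≤ s)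
    (hst : s < t) : Measurable (stepLaw η θ s t) := by
  have := isProbabilityMeasure_stepLaw hηθ hs hst
  refine Measurable.measure_of_isPiSystem_of_isProbabilityMeasure
    (borel_eq_generateFrom_isClosed (α := ℝ) ▸ BorelSpace.measurable_eq) isPiSystem_isClosed ?_
  intro F hF
  have hlim : ∀ x, Filter.Tendsto (fun n => ∫⁻ y, hF.apprSeq n y ∂stepLaw η θ s t x)
      Filter.atTop (nhds (stepLaw η θ s t x F)) := fun x =>
    HasOuterApproxClosed.tendsto_lintegral_apprSeq hF _
  refine measurable_of_tendsto_metrizable (fun n => ?_) (tendsto_pi_nhds.mpr hlim)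
  let f : BoundedContinuousFunction ℝ ℝ := ⟨⟨fun y => (hF.apprSeq n y : ℝ),
    NNReal.continuous_coe.comp (hF.apprSeq n).continuous⟩, (hF.apprSeq n).map_bounded'⟩
  have heq : ∀ x, ∫⁻ y, hF.apprSeq n y ∂stepLaw η θ s t x
      = ENNReal.ofReal (∫ y, f y ∂stepLaw η θ s t x) := fun x => by
    rw [← ENNReal.ofReal_toReal
      (BoundedContinuousFunction.lintegral_lt_top_of_nnreal _ (hF.apprSeq n)).ne,
      BoundedContinuousFunction.toReal_lintegral_coe_eq_integral]
    rfl
  simp_rw [heq]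
  exact (measurable_integral_stepLaw hηθ hs hst f).ennreal_ofReal


/-! ### Finite-dimensional distributions of the Markov process -/

section Filtrations

variable {Ω : Type*} {X : ℝ≥0 → Ω → ℝ}

lemma past_le [mΩ : MeasurableSpace Ω] (hX : ∀ t, Measurable (X t)) (s : ℝ≥0) : past X s ≤ mΩ :=
  iSup₂_le fun r _ => (hX r).comap_le

lemma measurable_past (X : ℝ≥0 → Ω → ℝ) {r s : ℝ≥0} (hrs : r ≤ s) : Measurable[past X s] (X r) :=
  measurable_iff_comap_le.mpr (le_iSup₂_of_le (f := fun r _ => MeasurableSpace.comap (X r) _)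
    r (Set.mem_Iic.mpr hrs) le_rfl)

lemma pastFuture_le [mΩ : MeasurableSpace Ω] (hX : ∀ t, Measurable (X t)) (s u : ℝ≥0) :
    pastFuture X s u ≤ mΩ :=
  iSup₂_le fun r _ => (hX r).comap_le

lemma measurable_pastFuture_left (X : ℝ≥0 → Ω → ℝ) {r s : ℝ≥0} (u : ℝ≥0) (hrs : r ≤ s) :
    Measurable[pastFuture X s u] (X r) :=
  measurable_iff_comap_le.mpr (le_iSup₂_of_le (f := fun r _ => MeasurableSpace.comap (X r) _)
    r (Or.inl (Set.mem_Iic.mpr hrs)) le_rfl)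

lemma measurable_pastFuture_right (X : ℝ≥0 → Ω → ℝ) {r u : ℝ≥0} (s : ℝ≥0) (hur : u ≤ r) :
    Measurable[pastFuture X s u] (X r) :=
  measurable_iff_comap_le.mpr (le_iSup₂_of_le (f := fun r _ => MeasurableSpace.comap (X r) _)
    r (Or.inr (Set.mem_Ici.mpr hur)) le_rfl)

lemma past_le_pastFuture (X : ℝ≥0 → Ω → ℝ) (s u : ℝ≥0) : past X s ≤ pastFuture X s u :=
  iSup₂_le fun _ hr => measurable_iff_comap_le.mp (measurable_pastFuture_left X u hr)

lemma past_mono (X : ℝ≥0 → Ω → ℝ) {s t : ℝ≥0} (hst : s ≤ t) : past X s ≤ past X t :=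
  iSup₂_le fun _ hr => measurable_iff_comap_le.mp (measurable_past X (le_trans hr hst))

end Filtrations

section Law

lemma map_restrict_biInter_insert {Ω : Type*} [MeasurableSpace Ω] (μ : Measure Ω)
    {Y : ℝ≥0 → Ω → ℝ} (hY : ∀ t, Measurable (Y t)) {A : ℝ≥0 → Set ℝ}
    (hA : ∀ j, MeasurableSet (A j)) (t : ℝ≥0) (J : Finset ℝ≥0) :
    (μ.restrict (⋂ j ∈ insert t J, Y j ⁻¹' A j)).map (Y t)
      = ((μ.restrict (⋂ j ∈ J, Y j ⁻¹' A j)).map (Y t)).restrict (A t) := by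
  rw [Measure.restrict_map (hY t) (hA t), Measure.restrict_restrict (hY t (hA t)),
    Finset.set_biInter_insert]

lemma measurableSet_past_biInter {Ω : Type*} (Y : ℝ≥0 → Ω → ℝ) {A : ℝ≥0 → Set ℝ}
    (hA : ∀ j, MeasurableSet (A j)) {J : Finset ℝ≥0} {t : ℝ≥0} (hJ : ∀ j ∈ J, j ≤ t) :
    MeasurableSet[past Y t] (⋂ j ∈ J, Y j ⁻¹' A j) :=
  Finset.measurableSet_biInter J fun j hj => measurable_past Y (hJ j hj) (hA j)

lemma preimage_univ_pi_eq {Ω : Type*} (Y : ℝ≥0 → Ω → ℝ) {I : Finset ℝ≥0} {A : I → Set ℝ}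
    {A₀ : ℝ≥0 → Set ℝ} (h : ∀ i : I, A₀ i = A i) :
    (fun ω (i : I) => Y i ω) ⁻¹' Set.univ.pi A = ⋂ j ∈ I, Y j ⁻¹' A₀ j := by
  ext ω
  simp only [Set.mem_preimage, Set.mem_univ_pi, Set.mem_iInter]
  constructor
  · intro hω j hj
    rw [h ⟨j, hj⟩]
    exact hω ⟨j, hj⟩
  · intro hω i
    rw [← h i]
    exact hω i i.2

variable {Ω : Type*} [mΩ : MeasurableSpace Ω] {μ : Measure Ω} [IsProbabilityMeasure μ]
  {η θ : ℝ} {Y : ℝ≥0 → Ω → ℝ}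

/-- On an event of the past of `t`, the law of `Y_u` arises from the law of `Y_t` by one step of
the transition kernel. -/
lemma IsFreeBiPoissonProcess.map_restrict (hηθ : 0 ≤ 1 + η * θ)
    (hY : IsFreeBiPoissonProcess η θ μ Y) {t u : ℝ≥0} (htu : t < u) {B : Set Ω}
    (hB : MeasurableSet[past Y t] B) :
    (μ.restrict B).map (Y u) = ((μ.restrict B).map (Y t)).bind (stepLaw η θ t u) := by
  have htu' : (t : ℝ) < u := by exact_mod_cast htu
  have hm := measurable_stepLaw hηθ t.coe_nonneg htu'
  have hprob := isProbabilityMeasure_stepLaw hηθ t.coe_nonneg htu'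
  ext A hA
  have hmA : Measurable fun x => stepLaw η θ t u x A := (Measure.measurable_coe hA).comp hm
  rw [Measure.bind_apply hA hm.aemeasurable, lintegral_map hmA (hY.measurable t),
    Measure.map_apply (hY.measurable u) hA, Measure.restrict_apply (hY.measurable u hA)]
  have hle := past_le hY.measurable t
  have h1 := setIntegral_condExp (μ := μ) hle
    ((integrable_const (1 : ℝ)).indicator (hY.measurable u hA)) hB
  rw [integral_indicator_const _ (hY.measurable u hA), smul_eq_mul, mul_one,
    measureReal_restrict_apply (hY.measurable u hA)] at h1
  have h2 : ∫ ω in B, (μ⟦Y u ⁻¹' A | past Y t⟧) ω ∂μ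
      = ∫ ω in B, (stepLaw η θ t u (Y t ω) A).toReal ∂μ := by
    refine integral_congr_ae (ae_restrict_of_ae ?_)
    filter_upwards [hY.transition t u htu A hA, hY.mem_stateSpace t] with ω h h'
    rw [h, stepLaw_of_mem h', measureReal_def]
  rw [h2, integral_toReal (f := fun ω => stepLaw η θ t u (Y t ω) A)
    (hmA.comp (hY.measurable t)).aemeasurable
    (Filter.Eventually.of_forall fun ω => measure_lt_top _ _), measureReal_def,
    ENNReal.toReal_eq_toReal_iff' _ (measure_ne_top _ _)] at h1
  · exact h1.symm
  · refine (lt_of_le_of_lt (lintegral_mono (g := fun _ => 1) fun ω => prob_le_one) ?_).ne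
    simp

lemma IsFreeBiPoissonProcess.map_zero (hY : IsFreeBiPoissonProcess η θ μ Y) :
    μ.map (Y 0) = Measure.dirac 0 := by
  rw [Measure.map_congr (g := fun _ => (0 : ℝ)) hY.start, Measure.map_const]
  simp

variable {Ω' : Type*} [mΩ' : MeasurableSpace Ω'] {μ' : Measure Ω'} [IsProbabilityMeasure μ']
  {Z : ℝ≥0 → Ω' → ℝ}

/-- The law of `Y_u` on an event that prescribes `Y` at finitely many earlier times depends on
the parameters only. -/
lemma IsFreeBiPoissonProcess.map_restrict_biInter_eq (hηθ : 0 ≤ 1 + η * θ)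
    (hY : IsFreeBiPoissonProcess η θ μ Y) (hZ : IsFreeBiPoissonProcess η θ μ' Z)
    {A : ℝ≥0 → Set ℝ} (hA : ∀ j, MeasurableSet (A j)) (J : Finset ℝ≥0) :
    ∀ u : ℝ≥0, (∀ j ∈ J, j < u) →
      (μ.restrict (⋂ j ∈ J, Y j ⁻¹' A j)).map (Y u)
        = (μ'.restrict (⋂ j ∈ J, Z j ⁻¹' A j)).map (Z u) := by
  induction J using Finset.induction_on_max with
  | empty =>
    intro u _
    simp only [Finset.notMem_empty, Set.iInter_of_empty, Set.iInter_univ, Measure.restrict_univ]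
    rcases eq_or_lt_of_le (zero_le (a := u)) with rfl | hu
    · rw [hY.map_zero, hZ.map_zero]
    · have h1 := hY.map_restrict hηθ hu (B := Set.univ) MeasurableSet.univ
      have h2 := hZ.map_restrict hηθ hu (B := Set.univ) MeasurableSet.univ
      rw [Measure.restrict_univ] at h1 h2
      rw [h1, h2, hY.map_zero, hZ.map_zero]
  | insert t J hJ ih =>
    intro u hu
    have htu : t < u := hu t (Finset.mem_insert_self t J)
    have hle : ∀ j ∈ insert t J, j ≤ t := by
      intro j hj
      rcases Finset.mem_insert.mp hj with rfl | hj
      exacts [le_rfl, (hJ j hj).le]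
    rw [hY.map_restrict hηθ htu (measurableSet_past_biInter Y hA hle),
      hZ.map_restrict hηθ htu (measurableSet_past_biInter Z hA hle)]
    congr 1
    rw [map_restrict_biInter_insert μ hY.measurable hA,
      map_restrict_biInter_insert μ' hZ.measurable hA,
      ih t hJ]

/-- The transition laws determine the finite-dimensional distributions. -/
lemma IsFreeBiPoissonProcess.identDistrib (hηθ : 0 ≤ 1 + η * θ)
    (hY : IsFreeBiPoissonProcess η θ μ Y) (hZ : IsFreeBiPoissonProcess η θ μ' Z)
    (I : Finset ℝ≥0) :
    IdentDistrib (fun ω (i : I) => Y i ω) (fun ω (i : I) => Z i ω) μ μ' := by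
  have hYm : Measurable fun ω (i : I) => Y i ω := measurable_pi_lambda _ fun i => hY.measurable i
  have hZm : Measurable fun ω (i : I) => Z i ω := measurable_pi_lambda _ fun i => hZ.measurable i
  refine ⟨hYm.aemeasurable, hZm.aemeasurable, ?_⟩
  have i1 : IsProbabilityMeasure (μ.map fun ω (i : I) => Y i ω) :=
    Measure.isProbabilityMeasure_map hYm.aemeasurable
  have i2 : IsProbabilityMeasure (μ'.map fun ω (i : I) => Z i ω) :=
    Measure.isProbabilityMeasure_map hZm.aemeasurable
  refine ext_of_generate_finite _ generateFrom_pi.symm isPiSystem_pi ?_ (by simp)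
  rintro _ ⟨A, hA, rfl⟩
  have hA' : ∀ i, MeasurableSet (A i) := fun i => hA i trivial
  classical
  let A₀ : ℝ≥0 → Set ℝ := fun j => if h : j ∈ I then A ⟨j, h⟩ else Set.univ
  have hA₀ : ∀ j, MeasurableSet (A₀ j) := by
    intro j
    by_cases h : j ∈ I
    · simp only [A₀, dif_pos h]; exact hA' _
    · simp only [A₀, dif_neg h]; exact MeasurableSet.univ
  have hAA : ∀ i : I, A₀ i = A i := fun i => dif_pos i.2
  obtain ⟨u, hu⟩ : ∃ u : ℝ≥0, ∀ j ∈ I, j < u :=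
    ⟨I.sup id + 1, fun j hj => lt_of_le_of_lt (Finset.le_sup (f := id) hj) (lt_add_one _)⟩
  have key := congrArg (fun ρ : Measure ℝ => ρ Set.univ)
    (hY.map_restrict_biInter_eq hηθ hZ hA₀ I u hu)
  simp only [Measure.map_apply (hY.measurable u) MeasurableSet.univ,
    Measure.map_apply (hZ.measurable u) MeasurableSet.univ, Set.preimage_univ,
    Measure.restrict_apply_univ] at key
  rw [Measure.map_apply hYm (MeasurableSet.univ_pi hA'),
    Measure.map_apply hZm (MeasurableSet.univ_pi hA'), preimage_univ_pi_eq Y hAA,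
    preimage_univ_pi_eq Z hAA, key]

end Law


/-! ### Commutation relation for the Jacobi coefficients -/

/-- The degree-two conditional moment relation, read in the basis `p_k`: if both sides have the
same coordinates except for the defects `d_t`, `d_u` in degree `m + 2`, these are proportional.
Multiplication by the variable acts on `span {p_k(·; t)}` as `A + t B` with `A`, `B` independent of
`t`, and what makes the coordinates match is the relation `B A = 1 + η A + θ B`. -/
lemma defect_quadratic {η θ s t u : ℝ} (hsu : s < u) (hu : 0 < u) (m : ℕ) (P : ℕ → ℝ)
    {dt du A₁ A₂ A₃ A₄ A₅ A₆ A₇ : ℝ}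
    (h₁ : A₁ = P (m + 2) + dt
      + (diagCoeff η θ t (m + 1) + diagCoeff η θ t m) * P (m + 1)
      + (lowCoeff η θ t (m + 1) + diagCoeff η θ t m ^ 2 + lowCoeff η θ t m) * P m
      + lowCoeff η θ t m * (diagCoeff η θ t m + diagCoeff η θ t (m - 1)) * P (m - 1)
      + lowCoeff η θ t m * lowCoeff η θ t (m - 1) * P (m - 1 - 1))
    (h₂ : A₂ = P (m + 2)
      + (diagCoeff η θ s (m + 1) + diagCoeff η θ s m) * P (m + 1)
      + (lowCoeff η θ s (m + 1) + diagCoeff η θ s m ^ 2 + lowCoeff η θ s m) * P m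
      + lowCoeff η θ s m * (diagCoeff η θ s m + diagCoeff η θ s (m - 1)) * P (m - 1)
      + lowCoeff η θ s m * lowCoeff η θ s (m - 1) * P (m - 1 - 1))
    (h₃ : A₃ = (P (m + 2) + diagCoeff η θ s (m + 1) * P (m + 1) + lowCoeff η θ s (m + 1) * P m)
      + diagCoeff η θ u m * (P (m + 1) + diagCoeff η θ s m * P m + lowCoeff η θ s m * P (m - 1))
      + lowCoeff η θ u m * (P (m - 1 + 1) + diagCoeff η θ s (m - 1) * P (m - 1)
        + lowCoeff η θ s (m - 1) * P (m - 1 - 1)))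
    (h₄ : A₄ = P (m + 2) + du
      + (diagCoeff η θ u (m + 1) + diagCoeff η θ u m) * P (m + 1)
      + (lowCoeff η θ u (m + 1) + diagCoeff η θ u m ^ 2 + lowCoeff η θ u m) * P m
      + lowCoeff η θ u m * (diagCoeff η θ u m + diagCoeff η θ u (m - 1)) * P (m - 1)
      + lowCoeff η θ u m * lowCoeff η θ u (m - 1) * P (m - 1 - 1))
    (h₅ : A₅ = P (m + 1) + diagCoeff η θ u m * P m + lowCoeff η θ u m * P (m - 1))
    (h₆ : A₆ = P (m + 1) + diagCoeff η θ s m * P m + lowCoeff η θ s m * P (m - 1))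
    (h₇ : A₇ = P m)
    (h₈ : A₁ = (((u - t) / (u - s)) ^ 2 + (u - t) * (t - s) / u * (u / (u - s) ^ 2)) * A₂
      + (2 * ((u - t) / (u - s)) * ((t - s) / (u - s))
        - (u - t) * (t - s) / u * ((u + s) / (u - s) ^ 2)) * A₃
      + (((t - s) / (u - s)) ^ 2 + (u - t) * (t - s) / u * (s / (u - s) ^ 2)) * A₄
      + (u - t) * (t - s) / u * ((θ - η * s) / (u - s)) * A₅
      + (u - t) * (t - s) / u * ((η * u - θ) / (u - s)) * A₆
      + (u - t) * (t - s) / u * A₇) :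
    dt = t * (t - s) / (u * (u - s)) * du := by
  have hus : u - s ≠ 0 := (sub_pos.mpr hsu).ne'
  have hu' := hu.ne'
  subst h₁ h₂ h₃ h₄ h₅ h₆ h₇
  rcases m with _ | _ | m
  all_goals
    simp only [diagCoeff, lowCoeff, Nat.add_eq_zero_iff, one_ne_zero, and_false, if_false, if_true,
      Nat.add_sub_cancel, zero_add, Nat.sub_self, Nat.zero_sub] at h₈ ⊢
    field_simp at h₈ ⊢
    apply mul_left_cancel₀ hus
    linear_combination h₈

/-- The analogue of `defect_quadratic` for the linear regression; it only uses that the Jacobi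
coefficients are affine in time. -/
lemma defect_linear {η θ s t u : ℝ} (hsu : s < u) (m : ℕ) (P : ℕ → ℝ) {dt du A₁ A₂ A₃ : ℝ}
    (h₁ : A₁ = P (m + 2) + dt + diagCoeff η θ t (m + 1) * P (m + 1)
      + lowCoeff η θ t (m + 1) * P m)
    (h₂ : A₂ = P (m + 2) + diagCoeff η θ s (m + 1) * P (m + 1) + lowCoeff η θ s (m + 1) * P m)
    (h₃ : A₃ = P (m + 2) + du + diagCoeff η θ u (m + 1) * P (m + 1)
      + lowCoeff η θ u (m + 1) * P m)
    (h : A₁ = (u - t) / (u - s) * A₂ + (t - s) / (u - s) * A₃) :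
    dt = (t - s) / (u - s) * du := by
  have hus : u - s ≠ 0 := (sub_pos.mpr hsu).ne'
  subst h₁ h₂ h₃
  simp only [diagCoeff, lowCoeff, Nat.add_eq_zero_iff, one_ne_zero, and_false, if_false] at h
  field_simp at h ⊢
  linear_combination h

lemma defect_eq_zero {s t u dt du : ℝ} (hs : 0 ≤ s) (hst : s < t) (htu : t < u)
    (h₁ : dt = (t - s) / (u - s) * du) (h₂ : dt = t * (t - s) / (u * (u - s)) * du) : dt = 0 := by
  have hu : 0 < u := by linarith
  have hus : u - s ≠ 0 := by linarith
  have hts : 0 < t - s := by linarith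
  have hut : 0 < u - t := by linarith
  have : (t - s) * (u - t) * du = 0 := by
    rw [h₁] at h₂
    field_simp at h₂
    linear_combination (t - s) * h₂
  have hdu : du = 0 := by simpa [hts.ne', hut.ne'] using this
  rw [h₁, hdu, mul_zero]


/-! ### Regressions of a quadratic harness -/

/-- Conditioning under a set integral: an `m`-measurable factor `h` allows `f` to be replaced by its
conditional expectation. -/
lemma setIntegral_mul_eq_of_condExp_eq {Ω : Type*} {m mΩ : MeasurableSpace Ω} {μ : Measure Ω}
    [IsFiniteMeasure μ] (hm : m ≤ mΩ) {f g h : Ω → ℝ} (hf : Integrable f μ)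
    (hfg : μ[f | m] =ᵐ[μ] g) (hh : Measurable[m] h) (hhf : Integrable (fun ω => h ω * f ω) μ)
    {B : Set Ω} (hB : MeasurableSet[m] B) :
    ∫ ω in B, h ω * f ω ∂μ = ∫ ω in B, h ω * g ω ∂μ := by
  have h1 := condExp_mul_of_stronglyMeasurable_left (μ := μ) hh.stronglyMeasurable hhf hf
  rw [← setIntegral_condExp hm hhf hB]
  refine integral_congr_ae (ae_restrict_of_ae ?_)
  filter_upwards [h1, hfg] with ω h1 h2
  change (μ[h * f | m]) ω = _
  rw [h1, Pi.mul_apply, h2]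

lemma exists_abs_eval_le (f : Polynomial ℝ) :
    ∃ C : ℝ, 0 ≤ C ∧ ∀ x : ℝ, |f.eval x| ≤ C * (1 + |x|) ^ f.natDegree := by
  refine ⟨∑ i ∈ Finset.range (f.natDegree + 1), |f.coeff i|,
    Finset.sum_nonneg fun _ _ => abs_nonneg _, fun x => ?_⟩
  rw [Polynomial.eval_eq_sum_range, Finset.sum_mul]
  refine (Finset.abs_sum_le_sum_abs _ _).trans (Finset.sum_le_sum fun i hi => ?_)
  rw [abs_mul, abs_pow]
  refine mul_le_mul_of_nonneg_left ?_ (abs_nonneg _)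
  have hx := abs_nonneg x
  exact (pow_le_pow_left₀ hx (by linarith) i).trans
    (pow_le_pow_right₀ (by linarith) (by rw [Finset.mem_range] at hi; omega))

lemma natDegree_mPoly_le (η θ t : ℝ) (n : ℕ) : (mPoly η θ t n).natDegree ≤ n := by
  induction n using Nat.strong_induction_on with
  | _ n ih =>
    rcases n with _ | _ | n
    · simp [mPoly]
    · simp [mPoly]
    · have h1 := ih n (by omega)
      have h2 := ih (n + 1) (by omega)
      rw [mPoly]
      refine (Polynomial.natDegree_sub_le _ _).trans (max_le ?_ ?_)
      · refine Polynomial.natDegree_mul_le.trans ?_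
        rw [Polynomial.natDegree_X_sub_C]
        omega
      · refine Polynomial.natDegree_mul_le.trans ?_
        rw [Polynomial.natDegree_C]
        omega

section Harness

variable {Ω : Type*} [mΩ : MeasurableSpace Ω] {μ : Measure Ω}
  {X : ℝ≥0 → Ω → ℝ} {η θ : ℝ}

lemma integrable_eval_mul_eval (hX : ∀ t, Measurable (X t)) {N : ℕ}
    (hI : ∀ t, Integrable (fun ω => (1 + |X t ω|) ^ N) μ) (s t : ℝ≥0) {f g : Polynomial ℝ}
    (hfg : f.natDegree + g.natDegree ≤ N) :
    Integrable (fun ω => f.eval (X s ω) * g.eval (X t ω)) μ := by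
  obtain ⟨C, hC, hf⟩ := exists_abs_eval_le f
  obtain ⟨D, hD, hg⟩ := exists_abs_eval_le g
  have hmeas : ∀ (q : Polynomial ℝ) (r : ℝ≥0), Measurable fun ω => q.eval (X r ω) := fun q r =>
    q.continuous.measurable.comp (hX r)
  refine Integrable.mono' (((hI s).add (hI t)).const_mul (C * D))
    ((hmeas f s).mul (hmeas g t)).aestronglyMeasurable (Filter.Eventually.of_forall fun ω => ?_)
  have h1 : (1 : ℝ) ≤ 1 + |X s ω| := by linarith [abs_nonneg (X s ω)]
  have h2 : (1 : ℝ) ≤ 1 + |X t ω| := by linarith [abs_nonneg (X t ω)]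
  rw [Real.norm_eq_abs, abs_mul]
  calc |f.eval (X s ω)| * |g.eval (X t ω)|
      ≤ (C * (1 + |X s ω|) ^ f.natDegree) * (D * (1 + |X t ω|) ^ g.natDegree) :=
        mul_le_mul (hf _) (hg _) (abs_nonneg _) (by positivity)
    _ = C * D * ((1 + |X s ω|) ^ f.natDegree * (1 + |X t ω|) ^ g.natDegree) := by ring
    _ ≤ C * D * ((1 + |X s ω|) ^ N + (1 + |X t ω|) ^ N) := by
        refine mul_le_mul_of_nonneg_left ?_ (by positivity)
        rcases le_total |X s ω| |X t ω| with h | h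
        · calc _ ≤ (1 + |X t ω|) ^ f.natDegree * (1 + |X t ω|) ^ g.natDegree := by gcongr
            _ = (1 + |X t ω|) ^ (f.natDegree + g.natDegree) := (pow_add _ _ _).symm
            _ ≤ (1 + |X t ω|) ^ N := pow_le_pow_right₀ h2 hfg
            _ ≤ _ := le_add_of_nonneg_left (by positivity)
        · calc _ ≤ (1 + |X s ω|) ^ f.natDegree * (1 + |X s ω|) ^ g.natDegree := by gcongr
            _ = (1 + |X s ω|) ^ (f.natDegree + g.natDegree) := (pow_add _ _ _).symm
            _ ≤ (1 + |X s ω|) ^ N := pow_le_pow_right₀ h1 hfg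
            _ ≤ _ := le_add_of_nonneg_right (by positivity)

lemma integrable_eval_of_le (hX : ∀ t, Measurable (X t)) {N : ℕ}
    (hI : ∀ t, Integrable (fun ω => (1 + |X t ω|) ^ N) μ) (t : ℝ≥0) {g : Polynomial ℝ}
    (hg : g.natDegree ≤ N) : Integrable (fun ω => g.eval (X t ω)) μ := by
  have := integrable_eval_mul_eval hX hI t t (f := 1) (g := g) (by simpa using hg)
  simpa using this

lemma HasBrownianCovariance.integrable_one_add_abs_sq [IsFiniteMeasure μ]
    (hcov : HasBrownianCovariance μ X)
    (t : ℝ≥0) : Integrable (fun ω => (1 + |X t ω|) ^ 2) μ := by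
  have h := ((memLp_const (1 : ℝ)).add (hcov.memLp t).norm).integrable_sq
  simpa only [Pi.add_apply, Real.norm_eq_abs] using h

lemma HasBrownianCovariance.start (hcov : HasBrownianCovariance μ X) : ∀ᵐ ω ∂μ, X 0 ω = 0 := by
  have h := hcov.cov 0 0
  rw [min_self, NNReal.coe_zero, integral_eq_zero_iff_of_nonneg (fun ω => mul_self_nonneg _)
    (by simpa [sq] using (hcov.memLp 0).integrable_sq)] at h
  filter_upwards [h] with ω hω
  simpa using hω

/-- The increments have the variance of Brownian increments. -/
lemma HasBrownianCovariance.integral_sub_sq (hcov : HasBrownianCovariance μ X) {s u : ℝ≥0}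
    (hsu : s ≤ u) : ∫ ω, (X u ω - X s ω) ^ 2 ∂μ = u - s := by
  have hi : ∀ a b, Integrable (fun ω => X a ω * X b ω) μ := fun a b =>
    (hcov.memLp a).integrable_mul (hcov.memLp b)
  have : (fun ω => (X u ω - X s ω) ^ 2) = fun ω => X u ω * X u ω - 2 * (X s ω * X u ω)
      + X s ω * X s ω := by funext ω; ring
  have hi' : Integrable (fun ω => X u ω * X u ω - 2 * (X s ω * X u ω)) μ :=
    (hi u u).sub ((hi s u).const_mul 2)
  rw [this, integral_add hi' (hi s s), integral_sub (hi u u) ((hi s u).const_mul 2),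
    integral_const_mul, hcov.cov, hcov.cov, hcov.cov,
    min_self, min_self, min_eq_left hsu]
  ring

/-- The process is a martingale: by the linear regression the defect `d_t = ∫_B (X_t - X_s)`
grows linearly in `t`, but it is at most `√(t - s)`. -/
lemma condExp_past_eq [IsProbabilityMeasure μ] (hcov : HasBrownianCovariance μ X)
    (hLR : HasLinearRegression μ X)
    {s t : ℝ≥0} (hst : s < t) : μ[X t | past X s] =ᵐ[μ] X s := by
  have hint : ∀ r, Integrable (X r) μ := fun r => (hcov.memLp r).integrable one_le_two
  have hle := past_le hcov.measurable s
  refine (ae_eq_condExp_of_forall_setIntegral_eq hle (hint t) (fun B _ _ => (hint s).integrableOn)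
    (fun B hB _ => ?_) (measurable_past X le_rfl).stronglyMeasurable.aestronglyMeasurable).symm
  set d : ℝ≥0 → ℝ := fun r => ∫ ω in B, (X r ω - X s ω) ∂μ with hd
  have hst' : (0 : ℝ) < t - s := sub_pos.mpr (by exact_mod_cast hst)
  have hlin : ∀ u, t < u → d t = ((t : ℝ) - s) / ((u : ℝ) - s) * d u := by
    intro u htu
    have hus : (u : ℝ) - s ≠ 0 := (sub_pos.mpr (by exact_mod_cast hst.trans htu)).ne'
    have h1 : ∫ ω in B, X t ω ∂μ = ∫ ω in B, (((u : ℝ) - t) / ((u : ℝ) - s) * X s ω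
        + ((t : ℝ) - s) / ((u : ℝ) - s) * X u ω) ∂μ := by
      rw [← setIntegral_condExp (pastFuture_le hcov.measurable s u) (hint t)
        (past_le_pastFuture X s u B hB)]
      exact integral_congr_ae (ae_restrict_of_ae (hLR s t u hst htu))
    rw [integral_add ((hint s).const_mul _).integrableOn ((hint u).const_mul _).integrableOn,
      integral_const_mul, integral_const_mul] at h1
    simp only [hd]
    rw [integral_sub (hint t).integrableOn (hint s).integrableOn,
      integral_sub (hint u).integrableOn (hint s).integrableOn, h1]
    field_simp
    ring
  have hbd : ∀ u, s ≤ u → d u ^ 2 ≤ u - s := by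
    intro u hsu
    have hsq : Integrable (fun ω => (X u ω - X s ω) ^ 2) μ :=
      ((hcov.memLp u).sub (hcov.memLp s)).integrable_sq
    have h1 : |d u| ≤ ∫ ω, |X u ω - X s ω| ∂μ :=
      (abs_integral_le_integral_abs).trans (setIntegral_le_integral
        ((hint u).sub (hint s)).abs (Filter.Eventually.of_forall fun ω => abs_nonneg _))
    have h2 : (∫ ω, |X u ω - X s ω| ∂μ) ^ 2 ≤ ∫ ω, |X u ω - X s ω| ^ 2 ∂μ := by
      have hv := variance_nonneg (fun ω => |X u ω - X s ω|) μ
      have hmem : MemLp (fun ω => |X u ω - X s ω|) 2 μ := ((hcov.memLp u).sub (hcov.memLp s)).norm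
      rw [variance_eq_sub hmem] at hv
      simpa using hv
    simp_rw [sq_abs] at h2
    rw [hcov.integral_sub_sq hsu] at h2
    calc d u ^ 2 = |d u| ^ 2 := (sq_abs _).symm
      _ ≤ (∫ ω, |X u ω - X s ω| ∂μ) ^ 2 := pow_le_pow_left₀ (abs_nonneg _) h1 2
      _ ≤ _ := h2
  have hdt : d t = 0 := by
    by_contra hne
    -- the two estimates give `d_t² (u - s) ≤ (t - s)²`, which fails for large `u`
    have hpos : 0 < d t ^ 2 := by positivity
    obtain ⟨n, hn⟩ := exists_nat_gt (((t : ℝ) - s) ^ 2 / d t ^ 2)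
    have htu : t < t + n + 1 := lt_of_le_of_lt le_self_add (lt_add_one _)
    have h1 := hlin _ htu
    have h2 := hbd _ (hst.trans htu).le
    have hus : (0 : ℝ) < ((t + n + 1 : ℝ≥0) : ℝ) - s := by
      rw [sub_pos]; exact_mod_cast hst.trans htu
    have hn' : (n : ℝ) < ((t + n + 1 : ℝ≥0) : ℝ) - s := by
      push_cast; linarith
    set w : ℝ := ((t + n + 1 : ℝ≥0) : ℝ) - s
    have h3 : d t ^ 2 * w ≤ ((t : ℝ) - s) ^ 2 := by
      rw [h1, mul_pow, div_pow]
      field_simp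
      gcongr
    rw [div_lt_iff₀ hpos] at hn
    nlinarith
  have := hdt
  simp only [hd] at this
  rw [integral_sub (hint t).integrableOn (hint s).integrableOn] at this
  linarith

/-- The conditional second moment, in terms of the conditional mean and variance. -/
lemma condExp_sq_pastFuture [IsFiniteMeasure μ] (hcov : HasBrownianCovariance μ X)
    (hLR : HasLinearRegression μ X)
    (hVar : HasFreeConditionalVariance η θ μ X) {s t u : ℝ≥0} (hst : s < t) (htu : t < u) :
    μ[fun ω => X t ω ^ 2 | pastFuture X s u] =ᵐ[μ] fun ω =>
      (((u : ℝ) - t) / ((u : ℝ) - s) * X s ω + ((t : ℝ) - s) / ((u : ℝ) - s) * X u ω) ^ 2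
      + ((u : ℝ) - t) * ((t : ℝ) - s) / u *
        (1 + η * ((u * X s ω - s * X u ω) / ((u : ℝ) - s))
          + θ * ((X u ω - X s ω) / ((u : ℝ) - s))
          + (X u ω - X s ω) * (s * X u ω - u * X s ω) / ((u : ℝ) - s) ^ 2) := by
  filter_upwards [hLR s t u hst htu, hVar s t u hst htu,
    condVar_ae_eq_condExp_sq_sub_sq_condExp (pastFuture_le hcov.measurable s u) (hcov.memLp t)]
    with ω h1 h2 h3
  rw [Pi.sub_apply, Pi.pow_apply, h1, h2] at h3
  have h4 : (μ[fun ω => X t ω ^ 2 | pastFuture X s u]) ω = (μ[X t ^ 2 | pastFuture X s u]) ω := rfl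
  rw [h4]
  linarith

end Harness


/-! ### The martingale polynomials along a quadratic harness -/

lemma integral_lin3 {α : Type*} [MeasurableSpace α] {ν : Measure α} {f₁ f₂ f₃ : α → ℝ}
    (h₁ : Integrable f₁ ν) (h₂ : Integrable f₂ ν) (h₃ : Integrable f₃ ν) (c₂ c₃ : ℝ) :
    ∫ a, (f₁ a + c₂ * f₂ a + c₃ * f₃ a) ∂ν = ∫ a, f₁ a ∂ν + c₂ * ∫ a, f₂ a ∂ν
      + c₃ * ∫ a, f₃ a ∂ν := by
  rw [integral_add (by fun_prop) (by fun_prop), integral_add (by fun_prop) (by fun_prop)]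
  simp only [integral_const_mul]

lemma integral_lin5 {α : Type*} [MeasurableSpace α] {ν : Measure α} {f₁ f₂ f₃ f₄ f₅ : α → ℝ}
    (h₁ : Integrable f₁ ν) (h₂ : Integrable f₂ ν) (h₃ : Integrable f₃ ν) (h₄ : Integrable f₄ ν)
    (h₅ : Integrable f₅ ν) (c₂ c₃ c₄ c₅ : ℝ) :
    ∫ a, (f₁ a + c₂ * f₂ a + c₃ * f₃ a + c₄ * f₄ a + c₅ * f₅ a) ∂ν
      = ∫ a, f₁ a ∂ν + c₂ * ∫ a, f₂ a ∂ν + c₃ * ∫ a, f₃ a ∂ν + c₄ * ∫ a, f₄ a ∂ν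
        + c₅ * ∫ a, f₅ a ∂ν := by
  rw [integral_add (by fun_prop) (by fun_prop), integral_add (by fun_prop) (by fun_prop),
    integral_lin3 h₁ h₂ h₃]
  simp only [integral_const_mul]

section Harness

variable {Ω : Type*} [mΩ : MeasurableSpace Ω] {μ : Measure Ω} [IsProbabilityMeasure μ]
  {X : ℝ≥0 → Ω → ℝ} {η θ : ℝ}

/-- If `E|X_t|^(m+2) < ∞` and `p_k(X_t; t)` is a martingale for `k ≤ m + 1`, then
`p_{m+2}(X_t; t)` is a martingale: computing `E(X_t p_{m+1}(X_u; u) | 𝓕_s)` and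
`E(X_t² p_m(X_u; u) | 𝓕_s)` once by conditioning on `𝓕_t` and once by conditioning on `𝓖_{s,u}`
gives two independent linear equations for the defects at the times `t` and `u`. -/
lemma condExp_mPoly_add_two (hcov : HasBrownianCovariance μ X) (hLR : HasLinearRegression μ X)
    (hVar : HasFreeConditionalVariance η θ μ X) {m : ℕ}
    (hI : ∀ t, Integrable (fun ω => (1 + |X t ω|) ^ (m + 2)) μ)
    (hM : ∀ k ≤ m + 1, ∀ s t : ℝ≥0, s < t →
      μ[fun ω => (mPoly η θ t k).eval (X t ω) | past X s] =ᵐ[μ]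
        fun ω => (mPoly η θ s k).eval (X s ω))
    {s t : ℝ≥0} (hst : s < t) :
    μ[fun ω => (mPoly η θ t (m + 2)).eval (X t ω) | past X s] =ᵐ[μ]
      fun ω => (mPoly η θ s (m + 2)).eval (X s ω) := by
  have hXm := hcov.measurable
  have hdeg := natDegree_mPoly_le η θ
  -- integrability of everything that occurs
  have i₀ : ∀ k ≤ m + 2, ∀ r : ℝ≥0, Integrable (fun ω => (mPoly η θ r k).eval (X r ω)) μ :=
    fun k hk r => integrable_eval_of_le hXm hI r ((hdeg r k).trans hk)
  have i₁ : ∀ k ≤ m + 1, ∀ a r : ℝ≥0,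
      Integrable (fun ω => X a ω * (mPoly η θ r k).eval (X r ω)) μ := fun k hk a r => by
    have hk' := hdeg r k
    have := integrable_eval_mul_eval hXm hI a r (f := Polynomial.X) (g := mPoly η θ r k)
      (by rw [Polynomial.natDegree_X]; omega)
    simpa using this
  have i₂ : ∀ a r : ℝ≥0, Integrable (fun ω => X a ω ^ 2 * (mPoly η θ r m).eval (X r ω)) μ :=
    fun a r => by
      have hk' := hdeg r m
      have := integrable_eval_mul_eval hXm hI a r (f := Polynomial.X ^ 2) (g := mPoly η θ r m)
        (by rw [Polynomial.natDegree_X_pow]; omega)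
      simpa using this
  have i₃ : ∀ a r : ℝ≥0,
      Integrable (fun ω => X a ω * (X r ω * (mPoly η θ r m).eval (X r ω))) μ := fun a r => by
    have hk' := hdeg r m
    have hd : (Polynomial.X * mPoly η θ r m).natDegree ≤ m + 1 :=
      Polynomial.natDegree_mul_le.trans (by rw [Polynomial.natDegree_X]; omega)
    have := integrable_eval_mul_eval hXm hI a r (f := Polynomial.X)
      (g := Polynomial.X * mPoly η θ r m) (by rw [Polynomial.natDegree_X]; omega)
    simpa using this
  refine (ae_eq_condExp_of_forall_setIntegral_eq (past_le hXm s) (i₀ _ le_rfl t)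
    (fun B _ _ => (i₀ _ le_rfl s).integrableOn) (fun B hB _ => ?_)
    ((mPoly η θ s (m + 2)).continuous.measurable.comp
      (measurable_past X le_rfl)).stronglyMeasurable.aestronglyMeasurable).symm
  obtain ⟨u, htu⟩ : ∃ u : ℝ≥0, t < u := ⟨t + 1, lt_add_one t⟩
  have hsu := hst.trans htu
  set P : ℕ → ℝ := fun k => ∫ ω in B, (mPoly η θ s k).eval (X s ω) ∂μ with hP
  -- the defect of `p_{m+2}` at time `r`
  set d : ℝ≥0 → ℝ := fun r => ∫ ω in B, (mPoly η θ r (m + 2)).eval (X r ω) ∂μ - P (m + 2) with hd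
  have hPd : ∀ r : ℝ≥0, ∫ ω in B, (mPoly η θ r (m + 2)).eval (X r ω) ∂μ = P (m + 2) + d r :=
    fun r => by simp only [hd]; ring
  have hPk : ∀ k ≤ m + 1, ∀ r : ℝ≥0, s ≤ r →
      ∫ ω in B, (mPoly η θ r k).eval (X r ω) ∂μ = P k := by
    intro k hk r hsr
    rcases hsr.eq_or_lt with rfl | hsr
    · rfl
    · rw [← setIntegral_condExp (past_le hXm s) (i₀ k (by omega) r) hB]
      exact integral_congr_ae (ae_restrict_of_ae (hM k hk s r hsr))
  have hds : d s = 0 := by simp [hd, hP]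
  have expand₁ : ∀ k ≤ m + 1, ∀ r : ℝ≥0, ∫ ω in B, X r ω * (mPoly η θ r k).eval (X r ω) ∂μ
      = ∫ ω in B, (mPoly η θ r (k + 1)).eval (X r ω) ∂μ
        + diagCoeff η θ r k * ∫ ω in B, (mPoly η θ r k).eval (X r ω) ∂μ
        + lowCoeff η θ r k * ∫ ω in B, (mPoly η θ r (k - 1)).eval (X r ω) ∂μ := by
    intro k hk r
    simp_rw [mul_eval_mPoly]
    exact integral_lin3 (i₀ _ (by omega) r).integrableOn (i₀ _ (by omega) r).integrableOn
      (i₀ _ (by omega) r).integrableOn _ _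
  have expand₂ : ∀ r : ℝ≥0, s ≤ r → ∫ ω in B, X r ω ^ 2 * (mPoly η θ r m).eval (X r ω) ∂μ
      = P (m + 2) + d r
      + (diagCoeff η θ r (m + 1) + diagCoeff η θ r m) * P (m + 1)
      + (lowCoeff η θ r (m + 1) + diagCoeff η θ r m ^ 2 + lowCoeff η θ r m) * P m
      + lowCoeff η θ r m * (diagCoeff η θ r m + diagCoeff η θ r (m - 1)) * P (m - 1)
      + lowCoeff η θ r m * lowCoeff η θ r (m - 1) * P (m - 1 - 1) := by
    intro r hsr
    simp_rw [sq_mul_eval_mPoly]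
    rw [integral_lin5 (i₀ _ (by omega) r).integrableOn (i₀ _ (by omega) r).integrableOn
      (i₀ _ (by omega) r).integrableOn (i₀ _ (by omega) r).integrableOn
      (i₀ _ (by omega) r).integrableOn, hPd, hPk _ (by omega) r hsr, hPk _ (by omega) r hsr,
      hPk _ (by omega) r hsr, hPk _ (by omega) r hsr]
  -- conditioning on `𝓕_s`
  have toPast : ∀ k ≤ m + 1, ∫ ω in B, X s ω * (mPoly η θ u k).eval (X u ω) ∂μ
      = ∫ ω in B, X s ω * (mPoly η θ s k).eval (X s ω) ∂μ := fun k hk =>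
    setIntegral_mul_eq_of_condExp_eq (past_le hXm s) (i₀ k (by omega) u) (hM k hk s u hsu)
      (measurable_past X le_rfl) (i₁ k hk s u) hB
  have toPast_sq : ∫ ω in B, X s ω ^ 2 * (mPoly η θ u m).eval (X u ω) ∂μ
      = ∫ ω in B, X s ω ^ 2 * (mPoly η θ s m).eval (X s ω) ∂μ :=
    setIntegral_mul_eq_of_condExp_eq (past_le hXm s) (i₀ m (by omega) u) (hM m (by omega) s u hsu)
      ((measurable_past X le_rfl).pow_const 2) (i₂ s u) hB
  -- conditioning on `𝓕_t`
  have hBt : MeasurableSet[past X t] B := past_mono X hst.le B hB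
  have viaPast₁ : ∫ ω in B, X t ω * (mPoly η θ u (m + 1)).eval (X u ω) ∂μ
      = ∫ ω in B, X t ω * (mPoly η θ t (m + 1)).eval (X t ω) ∂μ :=
    setIntegral_mul_eq_of_condExp_eq (past_le hXm t) (i₀ _ (by omega) u) (hM _ le_rfl t u htu)
      (measurable_past X le_rfl) (i₁ _ le_rfl t u) hBt
  have viaPast₂ : ∫ ω in B, X t ω ^ 2 * (mPoly η θ u m).eval (X u ω) ∂μ
      = ∫ ω in B, X t ω ^ 2 * (mPoly η θ t m).eval (X t ω) ∂μ :=
    setIntegral_mul_eq_of_condExp_eq (past_le hXm t) (i₀ _ (by omega) u) (hM _ (by omega) t u htu)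
      ((measurable_past X le_rfl).pow_const 2) (i₂ t u) hBt
  -- conditioning on `𝓖_{s,u}`
  have hBG : MeasurableSet[pastFuture X s u] B := past_le_pastFuture X s u B hB
  have hpG : ∀ k, Measurable[pastFuture X s u] fun ω => (mPoly η θ u k).eval (X u ω) := fun k =>
    (mPoly η θ u k).continuous.measurable.comp (measurable_pastFuture_right X s le_rfl)
  have viaG₁ : ∫ ω in B, X t ω * (mPoly η θ u (m + 1)).eval (X u ω) ∂μ
      = ((u : ℝ) - t) / ((u : ℝ) - s) * ∫ ω in B, X s ω * (mPoly η θ u (m + 1)).eval (X u ω) ∂μ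
        + ((t : ℝ) - s) / ((u : ℝ) - s)
          * ∫ ω in B, X u ω * (mPoly η θ u (m + 1)).eval (X u ω) ∂μ := by
    have h := setIntegral_mul_eq_of_condExp_eq (pastFuture_le hXm s u)
      ((hcov.memLp t).integrable one_le_two) (hLR s t u hst htu) (hpG (m + 1))
      (by simpa only [mul_comm] using i₁ _ le_rfl t u) hBG
    simp_rw [mul_comm (X t _)]
    rw [h, ← integral_const_mul, ← integral_const_mul,
      ← integral_add ((i₁ _ le_rfl s u).const_mul _).integrableOn
        ((i₁ _ le_rfl u u).const_mul _).integrableOn]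
    refine integral_congr_ae (Filter.Eventually.of_forall fun ω => ?_)
    ring
  have viaG₂ : ∫ ω in B, X t ω ^ 2 * (mPoly η θ u m).eval (X u ω) ∂μ
      = ((((u : ℝ) - t) / (u - s)) ^ 2 + (u - t) * (t - s) / u * (u / (u - s) ^ 2))
          * ∫ ω in B, X s ω ^ 2 * (mPoly η θ u m).eval (X u ω) ∂μ
      + (2 * (((u : ℝ) - t) / (u - s)) * ((t - s) / (u - s))
        - (u - t) * (t - s) / u * ((u + s) / (u - s) ^ 2))
          * ∫ ω in B, X s ω * (X u ω * (mPoly η θ u m).eval (X u ω)) ∂μ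
      + ((((t : ℝ) - s) / (u - s)) ^ 2 + (u - t) * (t - s) / u * (s / (u - s) ^ 2))
          * ∫ ω in B, X u ω ^ 2 * (mPoly η θ u m).eval (X u ω) ∂μ
      + ((u : ℝ) - t) * (t - s) / u * ((θ - η * s) / (u - s))
          * ∫ ω in B, X u ω * (mPoly η θ u m).eval (X u ω) ∂μ
      + ((u : ℝ) - t) * (t - s) / u * ((η * u - θ) / (u - s))
          * ∫ ω in B, X s ω * (mPoly η θ u m).eval (X u ω) ∂μ
      + ((u : ℝ) - t) * (t - s) / u * ∫ ω in B, (mPoly η θ u m).eval (X u ω) ∂μ := by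
    have h := setIntegral_mul_eq_of_condExp_eq (pastFuture_le hXm s u)
      (hcov.memLp t).integrable_sq (condExp_sq_pastFuture hcov hLR hVar hst htu) (hpG m)
      (by simpa only [mul_comm] using i₂ t u) hBG
    simp_rw [mul_comm (X t _ ^ 2)]
    have j₁ := (i₂ s u).integrableOn (s := B)
    have j₂ := (i₃ s u).integrableOn (s := B)
    have j₃ := (i₂ u u).integrableOn (s := B)
    have j₄ := (i₁ m (by omega) u u).integrableOn (s := B)
    have j₅ := (i₁ m (by omega) s u).integrableOn (s := B)
    have j₆ := (i₀ m (by omega) u).integrableOn (s := B)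
    rw [h, ← integral_const_mul, ← integral_lin5 (j₁.const_mul _) j₂ j₃ j₄ j₅,
      ← integral_const_mul, ← integral_add _ (j₆.const_mul _)]
    · refine integral_congr_ae (Filter.Eventually.of_forall fun ω => ?_)
      simp only []
      have hus : (u : ℝ) - s ≠ 0 := (sub_pos.mpr (by exact_mod_cast hsu)).ne'
      have hu : (u : ℝ) ≠ 0 := by
        have : (0 : ℝ) < u := by exact_mod_cast (zero_le (a := t)).trans_lt htu
        exact this.ne'
      field_simp
      ring
    · exact ((((j₁.const_mul _).add (j₂.const_mul _)).add (j₃.const_mul _)).add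
        (j₄.const_mul _)).add (j₅.const_mul _)
  have mixed : ∫ ω in B, X s ω * (X u ω * (mPoly η θ u m).eval (X u ω)) ∂μ
      = ∫ ω in B, X s ω * (mPoly η θ s (m + 1)).eval (X s ω) ∂μ
        + diagCoeff η θ u m * ∫ ω in B, X s ω * (mPoly η θ s m).eval (X s ω) ∂μ
        + lowCoeff η θ u m * ∫ ω in B, X s ω * (mPoly η θ s (m - 1)).eval (X s ω) ∂μ := by
    rw [← toPast _ le_rfl, ← toPast m (by omega), ← toPast (m - 1) (by omega),
      ← integral_lin3 (i₁ _ le_rfl s u).integrableOn (i₁ m (by omega) s u).integrableOn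
        (i₁ (m - 1) (by omega) s u).integrableOn]
    refine integral_congr_ae (Filter.Eventually.of_forall fun ω => ?_)
    simp only [mul_eval_mPoly η θ u m]
    ring
  have hsu' : (s : ℝ) < u := by exact_mod_cast hsu
  have hu' : (0 : ℝ) < u := s.coe_nonneg.trans_lt hsu'
  have lin : d t = ((t : ℝ) - s) / ((u : ℝ) - s) * d u := by
    refine defect_linear (η := η) (θ := θ) hsu' m P ?_ ?_ ?_ (viaPast₁.symm.trans viaG₁)
    · rw [expand₁ _ le_rfl, hPd, hPk _ le_rfl t hst.le, Nat.add_sub_cancel,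
        hPk m (by omega) t hst.le]
    · rw [toPast _ le_rfl, expand₁ _ le_rfl, Nat.add_sub_cancel]
    · rw [expand₁ _ le_rfl, hPd, hPk _ le_rfl u hsu.le, Nat.add_sub_cancel,
        hPk m (by omega) u hsu.le]
  have quad : d t = (t : ℝ) * (t - s) / (u * (u - s)) * d u := by
    refine defect_quadratic (η := η) (θ := θ) hsu' hu' m P (expand₂ t hst.le) ?_ ?_
      (expand₂ u hsu.le) ?_ ?_ ?_ (viaPast₂.symm.trans viaG₂)
    · rw [toPast_sq, expand₂ s le_rfl, hds, add_zero]
    · rw [mixed, expand₁ _ le_rfl, expand₁ m (by omega), expand₁ (m - 1) (by omega),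
        Nat.add_sub_cancel]
    · rw [expand₁ m (by omega), hPk _ (by omega) u hsu.le, hPk _ (by omega) u hsu.le,
        hPk _ (by omega) u hsu.le]
    · rw [toPast m (by omega), expand₁ m (by omega)]
    · exact hPk m (by omega) u hsu.le
  have hdt := defect_eq_zero s.coe_nonneg (by exact_mod_cast hst) (by exact_mod_cast htu) lin quad
  rw [hPd s, hPd t, hds, hdt]

/-- `p_0` and `p_1` are martingales. -/
lemma condExp_mPoly_le_one (hcov : HasBrownianCovariance μ X) (hLR : HasLinearRegression μ X)
    (k : ℕ) (hk : k ≤ 1) {s t : ℝ≥0} (hst : s < t) :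
    μ[fun ω => (mPoly η θ t k).eval (X t ω) | past X s] =ᵐ[μ]
      fun ω => (mPoly η θ s k).eval (X s ω) := by
  have hint : ∀ r, Integrable (X r) μ := fun r => (hcov.memLp r).integrable one_le_two
  have hle := past_le hcov.measurable s
  interval_cases k
  · simp only [mPoly, Polynomial.eval_one]
    rw [condExp_const hle]
  · simp only [mPoly, Polynomial.eval_sub, Polynomial.eval_X, Polynomial.eval_C]
    filter_upwards [condExp_sub (hint t) (integrable_const θ) (past X s),
      condExp_past_eq hcov hLR hst] with ω h1 h2
    rw [condExp_const hle] at h1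
    change (μ[X t - fun _ => θ | past X s]) ω = _
    rw [h1, Pi.sub_apply, h2]

/-- `p_2(X_t; t)` is a martingale; square-integrability is enough. -/
lemma condExp_mPoly_two (hcov : HasBrownianCovariance μ X) (hLR : HasLinearRegression μ X)
    (hVar : HasFreeConditionalVariance η θ μ X) {s t : ℝ≥0} (hst : s < t) :
    μ[fun ω => (mPoly η θ t 2).eval (X t ω) | past X s] =ᵐ[μ]
      fun ω => (mPoly η θ s 2).eval (X s ω) :=
  condExp_mPoly_add_two hcov hLR hVar (m := 0) hcov.integrable_one_add_abs_sq
    (fun k hk _ _ h => condExp_mPoly_le_one hcov hLR k hk h) hst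

lemma condExp_mPoly_of_integrable (hcov : HasBrownianCovariance μ X)
    (hLR : HasLinearRegression μ X) (hVar : HasFreeConditionalVariance η θ μ X)
    (hI : ∀ (N : ℕ) t, Integrable (fun ω => (1 + |X t ω|) ^ N) μ) (k : ℕ) :
    ∀ s t : ℝ≥0, s < t →
    μ[fun ω => (mPoly η θ t k).eval (X t ω) | past X s] =ᵐ[μ]
      fun ω => (mPoly η θ s k).eval (X s ω) := by
  induction k using Nat.strong_induction_on with
  | _ k ih =>
    intro s t hst
    rcases k with _ | _ | m
    · exact condExp_mPoly_le_one hcov hLR 0 (by omega) hst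
    · exact condExp_mPoly_le_one hcov hLR 1 le_rfl hst
    · exact condExp_mPoly_add_two hcov hLR hVar (hI (m + 2)) (fun k hk => ih k (by omega)) hst

/-! ### Conditional variances given the past, and moments of all orders -/

lemma condVar_past (hcov : HasBrownianCovariance μ X) (hLR : HasLinearRegression μ X)
    (hVar : HasFreeConditionalVariance η θ μ X) {s t : ℝ≥0} (hst : s < t) :
    condVar (past X s) (X t) μ =ᵐ[μ] fun ω => ((t : ℝ) - s) * (1 + X s ω * η) := by
  have hle := past_le hcov.measurable s
  have hint := (hcov.memLp t).integrable one_le_two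
  have hp := integrable_eval_of_le hcov.measurable hcov.integrable_one_add_abs_sq t
    (natDegree_mPoly_le η θ t 2)
  have hsq : X t ^ 2 = ((fun ω => (mPoly η θ t 2).eval (X t ω)) + (t * η + 2 * θ) • X t)
      + fun _ => t - θ ^ 2 := by
    funext ω
    simp [mPoly]
    ring
  filter_upwards [condVar_ae_eq_condExp_sq_sub_sq_condExp hle (hcov.memLp t),
    condExp_past_eq hcov hLR hst, condExp_mPoly_two hcov hLR hVar hst,
    condExp_add (hp.add (hint.smul (t * η + 2 * θ))) (integrable_const (t - θ ^ 2)) (past X s),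
    condExp_add hp (hint.smul (t * η + 2 * θ)) (past X s),
    condExp_smul (μ := μ) (t * η + 2 * θ) (X t) (past X s)] with ω h1 h2 h3 h4 h5 h6
  rw [condExp_const hle] at h4
  rw [h1, Pi.sub_apply, Pi.pow_apply, h2, hsq, h4, Pi.add_apply, h5, Pi.add_apply, h3, h6,
    Pi.smul_apply, h2]
  simp [mPoly]
  ring

lemma one_add_mul_nonneg (hcov : HasBrownianCovariance μ X) (hLR : HasLinearRegression μ X)
    (hVar : HasFreeConditionalVariance η θ μ X) (s : ℝ≥0) : ∀ᵐ ω ∂μ, 0 ≤ 1 + X s ω * η := by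
  have h0 : 0 ≤ᵐ[μ] condVar (past X s) (X (s + 1)) μ :=
    condExp_nonneg (Filter.Eventually.of_forall fun ω => sq_nonneg _)
  filter_upwards [h0, condVar_past hcov hLR hVar (lt_add_one s)] with ω h1 h2
  rw [h2] at h1
  simpa using h1

end Harness

/-- For `f ≥ 0` and an `m`-measurable weight `h ≥ 0`, integrability of `h E(f | m)` gives that of
`h f`, by truncating `h`. -/
lemma integrable_mul_of_condExp_mul {Ω : Type*} {m mΩ : MeasurableSpace Ω} {μ : Measure Ω}
    [IsFiniteMeasure μ] (hm : m ≤ mΩ) {f g h : Ω → ℝ} (hf : Integrable f μ) (hf0 : ∀ ω, 0 ≤ f ω)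
    (hfg : μ[f | m] =ᵐ[μ] g) (hh : Measurable[m] h) (hh0 : ∀ ω, 0 ≤ h ω)
    (hhg : Integrable (fun ω => h ω * g ω) μ) : Integrable (fun ω => h ω * f ω) μ := by
  let φ : ℕ → Set Ω := fun n => {ω | h ω ≤ n}
  have hφ : ∀ n, MeasurableSet[m] (φ n) := fun n => hh measurableSet_Iic
  have hcover : AECover μ Filter.atTop φ :=
    { ae_eventually_mem := Filter.Eventually.of_forall fun ω => by
        filter_upwards [Filter.eventually_ge_atTop ⌈h ω⌉₊] with n hn
        exact (Nat.le_ceil (h ω)).trans (by exact_mod_cast hn)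
      measurableSet := fun n => hm _ (hφ n) }
  have hind : ∀ n, Integrable (fun ω => (φ n).indicator h ω * f ω) μ := fun n => by
    refine hf.bdd_mul (c := n)
      ((hh.indicator (hφ n)).mono hm le_rfl).aestronglyMeasurable
      (Filter.Eventually.of_forall fun ω => ?_)
    by_cases hω : ω ∈ φ n
    · rw [Set.indicator_of_mem hω, Real.norm_of_nonneg (hh0 ω)]
      exact hω
    · rw [Set.indicator_of_notMem hω, norm_zero]
      positivity
  have heq : ∀ n, Set.EqOn (fun ω => (φ n).indicator h ω * f ω) (fun ω => h ω * f ω) (φ n) :=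
    fun n ω hω => by simp only [Set.indicator_of_mem hω]
  refine hcover.integrable_of_integral_bounded_of_nonneg_ae (∫ ω, |h ω * g ω| ∂μ)
    (fun n => ((hind n).integrableOn).congr_fun (heq n) (hm _ (hφ n)))
    (Filter.Eventually.of_forall fun ω => mul_nonneg (hh0 ω) (hf0 ω))
    (Filter.Eventually.of_forall fun n => ?_)
  rw [← setIntegral_congr_fun (hm _ (hφ n)) (heq n),
    setIntegral_mul_eq_of_condExp_eq hm hf hfg (hh.indicator (hφ n)) (hind n) (hφ n)]
  have heq' : Set.EqOn (fun ω => (φ n).indicator h ω * g ω) (fun ω => h ω * g ω) (φ n) :=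
    fun ω hω => by simp only [Set.indicator_of_mem hω]
  rw [setIntegral_congr_fun (hm _ (hφ n)) heq']
  refine (integral_mono hhg.integrableOn hhg.abs.integrableOn fun ω => le_abs_self _).trans ?_
  exact setIntegral_le_integral hhg.abs (Filter.Eventually.of_forall fun ω => abs_nonneg _)

/-- `|U|^(j+2)` is dominated by `(V - U/2)² |U|^j` and `(U - V)² |V|^j`, because `V = U / 2` and
`V = U` exclude each other unless both vanish. -/
lemma abs_pow_add_two_le (U V : ℝ) (j : ℕ) :
    |U| ^ (j + 2) ≤ 16 * (|U| ^ j * (V - U / 2) ^ 2) + 4 ^ (j + 2) * (|V| ^ j * (U - V) ^ 2) := by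
  rcases le_or_gt |U| (4 * |V - U / 2|) with h | h
  · have h1 : |U| ^ 2 ≤ 16 * (V - U / 2) ^ 2 := by
      rw [← sq_abs (V - U / 2)]
      nlinarith [abs_nonneg U]
    have h2 : 0 ≤ 4 ^ (j + 2) * (|V| ^ j * (U - V) ^ 2) := by positivity
    calc |U| ^ (j + 2) = |U| ^ j * |U| ^ 2 := pow_add _ _ _
      _ ≤ |U| ^ j * (16 * (V - U / 2) ^ 2) := by gcongr
      _ ≤ _ := by linarith
  · have hV : |U| ≤ 4 * |V| := by
      have := abs_sub_abs_le_abs_sub (U / 2) (U / 2 - V)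
      rw [abs_sub_comm (U / 2) V, abs_div, abs_two, sub_sub_cancel] at this
      linarith
    have hUV : |U| ≤ 4 * |U - V| := by
      have := abs_sub_abs_le_abs_sub (U / 2) (V - U / 2)
      rw [abs_div, abs_two, show U / 2 - (V - U / 2) = U - V by ring] at this
      linarith
    have h2 : 0 ≤ 16 * (|U| ^ j * (V - U / 2) ^ 2) := by positivity
    calc |U| ^ (j + 2) = |U| ^ j * |U| ^ 2 := pow_add _ _ _
      _ ≤ (4 * |V|) ^ j * (4 * |U - V|) ^ 2 := by gcongr
      _ = 4 ^ (j + 2) * (|V| ^ j * (U - V) ^ 2) := by rw [mul_pow, mul_pow, sq_abs, pow_add]; ring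
      _ ≤ _ := by linarith

lemma integrable_abs_pow_mul_affine {Ω : Type*} [MeasurableSpace Ω] {μ : Measure Ω}
    {X : ℝ≥0 → Ω → ℝ} (hX : ∀ t, Measurable (X t)) {j : ℕ} (t : ℝ≥0)
    (hI : Integrable (fun ω => (1 + |X t ω|) ^ (j + 1)) μ) (a b : ℝ) :
    Integrable (fun ω => |X t ω| ^ j * (a + b * X t ω)) μ := by
  refine Integrable.mono' (hI.const_mul (|a| + |b|)) ?_ (Filter.Eventually.of_forall fun ω => ?_)
  · have := hX t
    exact Measurable.aestronglyMeasurable (by fun_prop)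
  · rw [Real.norm_eq_abs, abs_mul, abs_pow, abs_abs, pow_succ]
    have hx := abs_nonneg (X t ω)
    have h1 : |a + b * X t ω| ≤ (|a| + |b|) * (1 + |X t ω|) := by
      refine (abs_add_le _ _).trans ?_
      rw [abs_mul]
      nlinarith [abs_nonneg a, abs_nonneg b, mul_nonneg (abs_nonneg a) hx]
    calc |X t ω| ^ j * |a + b * X t ω|
        ≤ (1 + |X t ω|) ^ j * ((|a| + |b|) * (1 + |X t ω|)) := by
          gcongr
          linarith
      _ = _ := by ring

lemma ae_integrable_condDistrib {α β : Type*} [MeasurableSpace α] [MeasurableSpace β]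
    {μ : Measure α} [IsFiniteMeasure μ] {Z : α → β} {Y : α → ℝ} (hZ : Measurable Z)
    (hY : Measurable Y) {f : ℝ → ℝ} (hf : Measurable f) (hfi : Integrable (fun a => f (Y a)) μ) :
    ∀ᵐ a ∂μ, Integrable f (condDistrib Y Z μ (Z a)) := by
  have hm : Measurable fun p : β × ℝ => f p.2 := hf.comp measurable_snd
  have hn : Integrable (fun p : β × ℝ => f p.2) (μ.map fun a => (Z a, Y a)) := by
    rw [integrable_map_measure hm.aestronglyMeasurable (hZ.prodMk hY).aemeasurable]
    exact hfi
  exact hn.condDistrib_ae hZ.aemeasurable hY.aemeasurable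

section Harness

variable {Ω : Type*} [mΩ : MeasurableSpace Ω] {μ : Measure Ω} [IsProbabilityMeasure μ]
  {X : ℝ≥0 → Ω → ℝ} {η θ : ℝ}

/-- The moments of order `j + 2` exist if those of order `j + 1` do: both `X_T` given `X_{T/2}`
and `X_{T/2}` given `X_T` have conditional variances of linear growth. -/
lemma integrable_pow_add_two (hcov : HasBrownianCovariance μ X) (hLR : HasLinearRegression μ X)
    (hVar : HasFreeConditionalVariance η θ μ X) {j : ℕ}
    (hI : ∀ t, Integrable (fun ω => (1 + |X t ω|) ^ (j + 1)) μ) {s t : ℝ≥0} (hs : 0 < s)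
    (hts : t = 2 * s) : Integrable (fun ω => |X t ω| ^ (j + 2)) μ := by
  have hXm := hcov.measurable
  have hst : s < t := by rw [hts, two_mul]; exact lt_add_of_pos_left s hs
  have hpow : ∀ (m : MeasurableSpace Ω) (r : ℝ≥0), Measurable[m] (X r) →
      Measurable[m] fun ω => |X r ω| ^ j := fun m r h => by
    have : Measurable fun x : ℝ => |x| ^ j := by fun_prop
    exact this.comp h
  have hsqi : ∀ f g : Ω → ℝ, MemLp f 2 μ → MemLp g 2 μ →
      Integrable (fun ω => (f ω - g ω) ^ 2) μ := fun f g hf hg => (hf.sub hg).integrable_sq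
  have h₁ : Integrable (fun ω => |X s ω| ^ j * (X t ω - X s ω) ^ 2) μ := by
    refine integrable_mul_of_condExp_mul (past_le hXm s)
      (g := fun ω => ((t : ℝ) - s) * (1 + X s ω * η)) (hsqi _ _ (hcov.memLp t) (hcov.memLp s))
      (fun ω => sq_nonneg _) ?_ (hpow _ s (measurable_past X le_rfl)) (fun ω => by positivity) ?_
    · refine Filter.EventuallyEq.trans (condExp_congr_ae ?_) (condVar_past hcov hLR hVar hst)
      filter_upwards [condExp_past_eq hcov hLR hst] with ω h
      simp [h]
    · refine (integrable_abs_pow_mul_affine hXm s (hI s) ((t : ℝ) - s) (((t : ℝ) - s) * η)).congr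
        (Filter.Eventually.of_forall fun ω => ?_)
      ring
  have ht2 : (t : ℝ) = 2 * s := by rw [hts]; push_cast; ring
  have hs' : (s : ℝ) ≠ 0 := by exact_mod_cast hs.ne'
  have h₂ : Integrable (fun ω => |X t ω| ^ j * (X s ω - X t ω / 2) ^ 2) μ := by
    refine integrable_mul_of_condExp_mul (pastFuture_le hXm 0 t)
      (g := fun ω => (s : ℝ) / 2 * (1 + θ * (X t ω / t)))
      (hsqi _ _ (hcov.memLp s) (by simpa [div_eq_inv_mul] using (hcov.memLp t).const_mul (2⁻¹ : ℝ)))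
      (fun ω => sq_nonneg _) ?_ (hpow _ t (measurable_pastFuture_right X 0 le_rfl))
      (fun ω => by positivity) ?_
    · refine Filter.EventuallyEq.trans (condExp_congr_ae ?_)
        ((hVar 0 s t hs hst).trans ?_)
      · filter_upwards [hLR 0 s t hs hst, hcov.start] with ω h h0
        simp only [Pi.pow_apply, Pi.sub_apply, h, h0, NNReal.coe_zero, ht2]
        field_simp
        ring
      · filter_upwards [hcov.start] with ω h0
        simp only [h0, NNReal.coe_zero, ht2]
        field_simp
        ring
    · refine (integrable_abs_pow_mul_affine hXm t (hI t) ((s : ℝ) / 2)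
        ((s : ℝ) / 2 * (θ / t))).congr (Filter.Eventually.of_forall fun ω => ?_)
      simp only []
      ring
  refine Integrable.mono' ((h₂.const_mul 16).add (h₁.const_mul (4 ^ (j + 2))))
    ((hXm t).abs.pow_const _).aestronglyMeasurable (Filter.Eventually.of_forall fun ω => ?_)
  rw [Real.norm_of_nonneg (by positivity)]
  exact abs_pow_add_two_le (X t ω) (X s ω) j

/-- All moments of the process are finite. -/
lemma integrable_one_add_abs_pow (hcov : HasBrownianCovariance μ X)
    (hLR : HasLinearRegression μ X) (hVar : HasFreeConditionalVariance η θ μ X) (N : ℕ) :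
    ∀ t, Integrable (fun ω => (1 + |X t ω|) ^ N) μ := by
  induction N with
  | zero => intro t; simp
  | succ N ih =>
    rcases N with _ | j
    · intro t
      simpa using (integrable_const (1 : ℝ)).add ((hcov.memLp t).integrable one_le_two).abs
    · intro t
      have hi : Integrable (fun ω => |X t ω| ^ (j + 2)) μ := by
        rcases eq_or_ne t 0 with rfl | ht
        · refine (integrable_zero Ω ℝ μ).congr ?_
          filter_upwards [hcov.start] with ω h
          simp [h]
        · exact integrable_pow_add_two hcov hLR hVar ih (s := t / 2)
            (by positivity) (by rw [mul_div_cancel₀ _ two_ne_zero])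
      refine Integrable.mono' (((integrable_const (1 : ℝ)).add hi).const_mul (2 ^ (j + 1)))
        (((hcov.measurable t).abs.const_add 1).pow_const _).aestronglyMeasurable
        (Filter.Eventually.of_forall fun ω => ?_)
      rw [Real.norm_of_nonneg (by positivity)]
      have := add_pow_le (zero_le_one (α := ℝ)) (abs_nonneg (X t ω)) (j + 2)
      simpa using this

/-- `p_k(X_t; t)` is a martingale for every `k`. -/
lemma condExp_mPoly (hcov : HasBrownianCovariance μ X)
    (hLR : HasLinearRegression μ X) (hVar : HasFreeConditionalVariance η θ μ X) (k : ℕ)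
    {s t : ℝ≥0} (hst : s < t) :
    μ[fun ω => (mPoly η θ t k).eval (X t ω) | past X s] =ᵐ[μ]
      fun ω => (mPoly η θ s k).eval (X s ω) :=
  condExp_mPoly_of_integrable hcov hLR hVar
    (fun N => integrable_one_add_abs_pow hcov hLR hVar N) k s t hst

/-- The conditional distribution of `X_t` given the past of `s` is the transition law. -/
lemma HasBrownianCovariance.isFreeBiPoissonProcess (hηθ : 0 ≤ 1 + η * θ)
    (hcov : HasBrownianCovariance μ X)
    (hLR : HasLinearRegression μ X) (hVar : HasFreeConditionalVariance η θ μ X) :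
    IsFreeBiPoissonProcess η θ μ X where
  measurable := hcov.measurable
  start := hcov.start
  mem_stateSpace := one_add_mul_nonneg hcov hLR hVar
  transition := by
    intro s t hst A hA
    have hXm := hcov.measurable
    have hle := past_le hXm s
    have hst' : (s : ℝ) < t := by exact_mod_cast hst
    have hid : Measurable[mΩ, past X s] (id : Ω → Ω) := measurable_id'' hle
    have hI := integrable_one_add_abs_pow hcov hLR hVar
    have hint : ∀ q : Polynomial ℝ, Integrable (fun ω => q.eval (X t ω)) μ := fun q =>
      integrable_eval_of_le hXm (hI q.natDegree) t le_rfl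
    -- the regular conditional distribution of `X_t` given the `σ`-field `𝓕_s` on `Ω`
    let κ := @condDistrib Ω Ω ℝ _ _ _ mΩ (past X s) (X t) id μ _
    have hpow : ∀ᵐ ω ∂μ, ∀ n : ℕ, Integrable (fun y : ℝ => y ^ n) (κ ω) := by
      rw [ae_all_iff]
      intro n
      exact @ae_integrable_condDistrib Ω Ω mΩ (past X s) μ _ id (X t) hid (hXm t) (fun y => y ^ n)
        (measurable_id.pow_const n) (by simpa using hint (Polynomial.X ^ n))
    have hmom : ∀ᵐ ω ∂μ, ∀ n : ℕ, ∫ y, (mPoly η θ t n).eval y ∂(κ ω)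
        = (mPoly η θ s n).eval (X s ω) := by
      rw [ae_all_iff]
      intro n
      have h1 := condExp_ae_eq_integral_condDistrib (μ := μ) hid (hXm t).aemeasurable
        (mPoly η θ t n).continuous.stronglyMeasurable (hint _)
      rw [MeasurableSpace.comap_id] at h1
      filter_upwards [h1, condExp_mPoly hcov hLR hVar n hst] with ω h1 h2
      rw [← h2, h1]
      rfl
    have hcond := condDistrib_ae_eq_condExp (μ := μ) hid (hXm t) hA
    rw [MeasurableSpace.comap_id] at hcond
    filter_upwards [hpow, hmom, hcond, one_add_mul_nonneg hcov hLR hVar s] with ω h1 h2 h3 h4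
    rw [← h3, eq_of_integral_mPoly hηθ s.coe_nonneg hst' h4
      (makesOrthogonal_transitionLaw hηθ s.coe_nonneg hst' h4) h1 h2]
    rfl

end Harness

end BiPoisson

theorem theorem3p1 {Ω : Type*} [MeasurableSpace Ω] (μ : Measure Ω) [IsProbabilityMeasure μ]
    (X : ℝ≥0 → Ω → ℝ) (η θ : ℝ) (hηθ : 0 ≤ 1 + η * θ)
    (hcov : BiPoisson.HasBrownianCovariance μ X)
    (hLR : BiPoisson.HasLinearRegression μ X)
    (hVar : BiPoisson.HasFreeConditionalVariance η θ μ X) :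
    -- the transition probabilities are well defined
    (∀ s t x : ℝ, 0 ≤ s → s < t → 0 ≤ 1 + x * η →
      ∃! ν : Measure ℝ, BiPoisson.MakesOrthogonal (BiPoisson.Q η θ s t x) ν) ∧
    -- `X` is the Markov process with these transition probabilities
    BiPoisson.IsFreeBiPoissonProcess η θ μ X ∧
    -- and this determines the finite-dimensional distributions
    (∀ (Ω' : Type*) [MeasurableSpace Ω'] (μ' : Measure Ω') [IsProbabilityMeasure μ']
      (Y : ℝ≥0 → Ω' → ℝ), BiPoisson.IsFreeBiPoissonProcess η θ μ' Y →
      ∀ I : Finset ℝ≥0,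
        IdentDistrib (fun ω (i : I) => X i ω) (fun ω (i : I) => Y i ω) μ μ') := by
  have hX := hcov.isFreeBiPoissonProcess hηθ hLR hVar
  exact ⟨fun s t x hs hst hx => BiPoisson.existsUnique_makesOrthogonal hηθ hs hst hx, hX,
    fun Ω' _ μ' _ Y hY I => hX.identDistrib hηθ hY I⟩
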